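/- Let $Z\sim\mathcal N(0,1)$ and consider the channel $Y=X+Z$, where the input $X$ is independent of $Z$. Let $I(X;Y)$ denote mutual information (natural logarithms), let $\operatorname{supp}(P_X)$ denote the support of the law $P_X$ of $X$, and for $A>0$, $\varepsilon>0$ put $$C(A)=\sup_{P_X:\ \operatorname{supp}(P_X)\subset[-A,A]} I(X;Y),$$ $$K_\varepsilon(A)=\min\bigl\{|\operatorname{supp}(P_X)|:\ P_X\text{ discrete},\ \operatorname{supp}(P_X)\subset[-A,A],\ I(X;Y)\ge C(A)-\varepsilon\bigr\}.$$ Write $\log^+x=\max\{\log x,0\}$ and define the constants $$\alpha_0=\int_{-1}^{1}e^{-t^2/2}\,dt,\qquad M_0=\Bigl(\frac3\pi+\frac1{\sqrt{2\pi}}\Bigr)\frac{2e^2}{\alpha_0}\,\pi e^2,\qquad c_L=\frac1{8(2\pi M_0+1)},\qquad b_0=\sqrt{\frac{\pi e}{2}},\qquad c=\frac{2c_L^2}{1+b_0}.$$ Then for all $A\ge1$ and all $0<\varepsilon\le 1/A$, $$K_\varepsilon(A)\ \ge\ \frac{A}{2\pi}\sqrt{\log^+\!\left(\frac{c_L}{\sqrt{\varepsilon/2}+\sqrt{b_0/(2A)}}\right)}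 \qquad\text{and}\qquad K_\varepsilon(A)\ \ge\ \frac{A}{2\sqrt2\,\pi}\sqrt{\log^+(cA)}.$$ -/

import Mathlib

open MeasureTheory ProbabilityTheory

namespace AmplitudeChannel

noncomputable section

open scoped ENNReal

/-- Mutual information of a pair with joint law `ρ`: the relative entropy
(natural logarithm) of `ρ` with respect to the product of its marginals. -/
def mutualInfo {α β : Type*} [MeasurableSpace α] [MeasurableSpace β]
    (ρ : Measure (α × β)) : ℝ≥0∞ :=
  InformationTheory.klDiv ρ (ρ.fst.prod ρ.snd)

/-- Joint law of `(X, Y)` with `Y = X + Z`, where `X` has law `P` and `Z` is a standard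
normal variable independent of `X`. -/
def inputOutputLaw (P : Measure ℝ) : Measure (ℝ × ℝ) :=
  (P.prod (gaussianReal 0 1)).map (fun p => (p.1, p.1 + p.2))

/-- `I(X; Y)` for the input law `P`. -/
def channelInfo (P : Measure ℝ) : ℝ≥0∞ :=
  mutualInfo (inputOutputLaw P)

/-- `P` is a probability law on `ℝ` with support contained in `[-A, A]`. -/
def IsInput (A : ℝ) (P : Measure ℝ) : Prop :=
  IsProbabilityMeasure P ∧ P.support ⊆ Set.Icc (-A) A

/-- `C(A)`, the supremum of `I(X; Y)` over all input laws supported in `[-A, A]`. -/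
def capacity (A : ℝ) : ℝ≥0∞ :=
  ⨆ (P : Measure ℝ) (_ : IsInput A P), channelInfo P

/-- A law is discrete if it is carried by a countable set. -/
def IsDiscrete (P : Measure ℝ) : Prop :=
  ∃ S : Set ℝ, S.Countable ∧ P Sᶜ = 0

/-- The discrete input laws supported in `[-A, A]` with `I(X; Y) ≥ C(A) - ε`. -/
def IsNearOptimal (ε A : ℝ) (P : Measure ℝ) : Prop :=
  IsInput A P ∧ IsDiscrete P ∧ capacity A ≤ channelInfo P + ENNReal.ofReal ε

/-- `K_ε(A)`: the least number of support points of a discrete input supported in `[-A, A]`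
whose mutual information is within `ε` of capacity (the infimum is taken in `ℕ∞`, so it is
attained as soon as such an input exists). -/
def minSupportSize (ε A : ℝ) : ℕ∞ :=
  sInf {k : ℕ∞ | ∃ P : Measure ℝ, IsNearOptimal ε A P ∧ k = P.support.encard}

/-- `α₀ = ∫_{-1}^{1} e^{-t²/2} dt`. -/
def alpha0 : ℝ := ∫ t in (-1 : ℝ)..1, Real.exp (-t ^ 2 / 2)

/-- `M₀ = (3/π + 1/√(2π)) · (2e²/α₀) · π e²`. -/
def M0 : ℝ :=
  (3 / Real.pi + 1 / √(2 * Real.pi)) * (2 * Real.exp 1 ^ 2 / alpha0)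
    * (Real.pi * Real.exp 1 ^ 2)

/-- `c_L = 1 / (8 (2π M₀ + 1))`. -/
def cL : ℝ := 1 / (8 * (2 * Real.pi * M0 + 1))

/-- `b₀ = √(π e / 2)`. -/
def b0 : ℝ := √(Real.pi * Real.exp 1 / 2)

/-- `c = 2 c_L² / (1 + b₀)`. -/
def c0 : ℝ := 2 * cL ^ 2 / (1 + b0)

end

end AmplitudeChannel

/-!
The bound compares the output density `f` of a near-optimal input `P` with the function
`q = 1 / (2A)` on `[-A, A]`, continued outside by Gaussian tails.

*Near-optimal outputs are nearly flat.* For bounded inputs `I(X; Y) = h(Y) - h(Z)`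
(`channelInfo_eq`). The output density of the uniform input is at most `1 / (2A)`, so
`C(A) ≥ log (2A) - h(Z)` (`log_sub_le_capacity`), and near-optimality of `P` gives
`h(Y) ≥ log (2A) - ε`. The tails of `q` are raised by the factor `√e`, which makes
`E [-log q(x + Z)] ≤ log (2A)` for every `x ∈ [-A, A]`, the end points included
(`integral_outsideCost_gaussian_nonpos`), while the tails still have mass `O(1 / A)`. Hence the
relative entropy of `f` with respect to `q` is at most `ε + O(1 / A)`, and a weak form of Pinsker's
inequality turns this into an `L¹` bound of the order of `δ = √((ε + b₀ / A) / 2)`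
(`IsNearOptimal.integral_abs_sub_le`).

*Few atoms cannot produce a flat output.* If `P` has `K` support points, there is a function `g`
whose Gaussian smoothing is nonpositive at these points, so that `∫ f g ≤ 0`, whose mean over
`[-A, A]` is at least `3 / 8`, and with `|g| ≤ 6 exp (2 (πK / A)²)` (`exists_testFunction`). Without
smoothing, such a function is `1` minus multiples of Fejér kernels of degree `2K` on the circle of
length `2A`, one for each bin of a grid that contains a support point. Undoing the smoothing
multiplies the `m`-th Fourier coefficient by `exp ((πm / A)² / 2)`; the resulting kernels are
Gaussian averages of squared Dirichlet sums, and Parseval's identity on the grid bounds the sum of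
their absolute values over all bins without a loss of a factor `K` (`sum_norm_deconvFejer_le`).

Testing `q - f` against `g` gives `1 ≤ 144 δ exp (2 (πK / A)²)`, and `c_L ≤ 1 / 144`.
-/

namespace AmplitudeChannel

open scoped ENNReal

/-! ### Trigonometric polynomials on a grid -/

/-- Orthogonality of characters on a grid of `M` equally spaced points. -/
lemma sum_exp_grid {M : ℕ} (hM : 0 < M) (m : ℤ) (hm : |m| < M) (x : ℝ) :
    ∑ b ∈ Finset.range M, Complex.exp (m * (x - 2 * Real.pi * b / M) * Complex.I)
      = if m = 0 then (M : ℂ) else 0 := by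
  have hM' : (M : ℂ) ≠ 0 := by exact_mod_cast hM.ne'
  split_ifs with h
  · simp [h]
  set ω : ℂ := Complex.exp (-(m * (2 * Real.pi / M) * Complex.I)) with hω
  have hterm : ∀ b ∈ Finset.range M,
      Complex.exp (m * (x - 2 * Real.pi * b / M) * Complex.I)
        = Complex.exp (m * x * Complex.I) * ω ^ b := by
    intro b _
    rw [hω, ← Complex.exp_nat_mul, ← Complex.exp_add]
    congr 1
    ring
  rw [Finset.sum_congr rfl hterm, ← Finset.mul_sum]
  have hω1 : ω ≠ 1 := by
    intro h1
    obtain ⟨n, hn⟩ := Complex.exp_eq_one_iff.1 h1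
    have h2 : (2 * Real.pi * Complex.I : ℂ) ≠ 0 := Complex.two_pi_I_ne_zero
    have h3 : (-m : ℂ) = n * M := by
      field_simp at hn
      have : (2 * Real.pi * Complex.I : ℂ) * (-m) = (2 * Real.pi * Complex.I : ℂ) * (n * M) := by
        linear_combination (2 * Real.pi * Complex.I : ℂ) * hn
      exact mul_left_cancel₀ h2 this
    have h4 : -m = n * M := by exact_mod_cast h3
    have h5 : |m| = |n| * M := by rw [← abs_neg, h4, abs_mul, Nat.abs_cast]
    have hn0 : n ≠ 0 := by
      rintro rfl
      apply h
      simpa using h4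
    have h6 : 1 ≤ |n| := Int.one_le_abs hn0
    nlinarith
  have hωM : ω ^ M = 1 := by
    rw [hω, ← Complex.exp_nat_mul, Complex.exp_eq_one_iff]
    refine ⟨-m, ?_⟩
    push_cast
    field_simp
  rw [geom_sum_eq hω1, hωM]
  simp

/-- Parseval's identity for trigonometric polynomials of degree `K` sampled on a grid of
`M > 2K` equally spaced points. -/
lemma sum_norm_sq_grid {M K : ℕ} (hM : 2 * K < M) (a : ℤ → ℂ) (x : ℝ) :
    ∑ b ∈ Finset.range M, ‖∑ k ∈ Finset.Icc (-K : ℤ) K,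
        a k * Complex.exp (k * (x - 2 * Real.pi * b / M) * Complex.I)‖ ^ 2
      = M * ∑ k ∈ Finset.Icc (-K : ℤ) K, ‖a k‖ ^ 2 := by
  have hM0 : 0 < M := by omega
  have key : ∀ b : ℕ, ((‖∑ k ∈ Finset.Icc (-K : ℤ) K,
        a k * Complex.exp (k * (x - 2 * Real.pi * b / M) * Complex.I)‖ ^ 2 : ℝ) : ℂ)
      = ∑ k ∈ Finset.Icc (-K : ℤ) K, ∑ l ∈ Finset.Icc (-K : ℤ) K,
        a k * (starRingEnd ℂ) (a l) *
          Complex.exp (((k - l : ℤ) : ℂ) * (x - 2 * Real.pi * b / M) * Complex.I) := by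
    intro b
    push_cast
    rw [← Complex.mul_conj', map_sum, Finset.sum_mul_sum]
    refine Finset.sum_congr rfl fun k _ => Finset.sum_congr rfl fun l _ => ?_
    rw [map_mul, ← Complex.exp_conj]
    have : (starRingEnd ℂ) (l * (x - 2 * Real.pi * b / M) * Complex.I)
        = -(l * (x - 2 * Real.pi * b / M) * Complex.I) := by
      simp [Complex.conj_ofReal, map_ofNat (starRingEnd ℂ) 2]
    rw [this, mul_mul_mul_comm, ← Complex.exp_add]
    congr 2
    ring
  have : ((∑ b ∈ Finset.range M, ‖∑ k ∈ Finset.Icc (-K : ℤ) K,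
        a k * Complex.exp (k * (x - 2 * Real.pi * b / M) * Complex.I)‖ ^ 2 : ℝ) : ℂ)
      = ((M * ∑ k ∈ Finset.Icc (-K : ℤ) K, ‖a k‖ ^ 2 : ℝ) : ℂ) := by
    rw [Complex.ofReal_sum, Finset.sum_congr rfl fun b _ => key b, Finset.sum_comm]
    push_cast
    rw [Finset.mul_sum]
    refine Finset.sum_congr rfl fun k hk => ?_
    rw [Finset.sum_comm]
    have : ∀ l ∈ Finset.Icc (-K : ℤ) K, ∑ b ∈ Finset.range M, a k * (starRingEnd ℂ) (a l) *
          Complex.exp ((k - l : ℂ) * (x - 2 * Real.pi * b / M) * Complex.I)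
        = if k = l then (M : ℂ) * ‖a k‖ ^ 2 else 0 := by
      intro l hl
      rw [← Finset.mul_sum]
      have hkl : |k - l| < M := by
        rw [Finset.mem_Icc] at hk hl
        rw [abs_lt]
        omega
      have h := sum_exp_grid hM0 (k - l) hkl x
      push_cast at h
      rw [h]
      by_cases hh : k = l
      · subst hh
        simp [Complex.mul_conj', mul_comm]
      · simp [hh, sub_eq_zero]
    rw [Finset.sum_congr rfl this]
    simp only [Finset.sum_ite_eq, if_pos hk]
  exact_mod_cast this

/-! ### The deconvolved Fejér kernel -/

/-- The Dirichlet-type sum `∑_{|k| ≤ K} e^{k (s + i x)}`: the Dirichlet kernel at a complex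
point. -/
noncomputable def dirichletSum (K : ℕ) (s x : ℝ) : ℂ :=
  ∑ k ∈ Finset.Icc (-K : ℤ) K, Complex.exp (k * s) * Complex.exp (k * x * Complex.I)

/-- The Fejér kernel of degree `2K`, normalised to be `1` at the origin, with the `m`-th Fourier
coefficient multiplied by `e^{(m σ)² / 2}`: smoothing by a Gaussian of standard deviation `σ`
turns it back into the Fejér kernel. The Fejér kernel is expanded as the square of the Dirichlet
kernel, whence the double sum. -/
noncomputable def deconvFejer (K : ℕ) (σ x : ℝ) : ℂ :=
  (1 / (2 * K + 1) ^ 2 : ℂ) * ∑ k ∈ Finset.Icc (-K : ℤ) K, ∑ l ∈ Finset.Icc (-K : ℤ) K,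
    Complex.exp (((k + l : ℤ) * σ) ^ 2 / 2) * Complex.exp ((k + l : ℤ) * x * Complex.I)

lemma dirichletSum_sq (K : ℕ) (s x : ℝ) :
    dirichletSum K s x ^ 2 = ∑ k ∈ Finset.Icc (-K : ℤ) K, ∑ l ∈ Finset.Icc (-K : ℤ) K,
      Complex.exp ((k + l : ℤ) * s) * Complex.exp ((k + l : ℤ) * x * Complex.I) := by
  rw [sq, dirichletSum, Finset.sum_mul_sum]
  refine Finset.sum_congr rfl fun k _ => Finset.sum_congr rfl fun l _ => ?_
  rw [mul_mul_mul_comm, ← Complex.exp_add, ← Complex.exp_add]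
  push_cast
  congr 2 <;> ring

lemma integral_exp_mul_gaussian (t : ℝ) :
    ∫ z, Real.exp (t * z) ∂gaussianReal 0 1 = Real.exp (t ^ 2 / 2) := by
  have h := congrFun (mgf_id_gaussianReal (μ := 0) (v := 1)) t
  simpa [mgf] using h

lemma integral_cexp_mul_gaussian (t : ℝ) :
    ∫ z, Complex.exp (t * z) ∂gaussianReal 0 1 = Complex.exp (t ^ 2 / 2) := by
  have h : ∀ z : ℝ, Complex.exp (t * z) = ((Real.exp (t * z) : ℝ) : ℂ) := by
    intro z; push_cast; rfl
  simp_rw [h]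
  rw [integral_complex_ofReal, integral_exp_mul_gaussian]
  push_cast
  rfl

lemma integrable_cexp_mul_gaussian (t : ℝ) :
    Integrable (fun z : ℝ => Complex.exp (t * z)) (gaussianReal 0 1) := by
  have h : ∀ z : ℝ, Complex.exp (t * z) = ((Real.exp (t * z) : ℝ) : ℂ) := by
    intro z; push_cast; rfl
  simp_rw [h]
  exact (integrable_exp_mul_gaussianReal t).ofReal

lemma integral_cexp_I_gaussian (t : ℝ) :
    ∫ z, Complex.exp (t * z * Complex.I) ∂gaussianReal 0 1 = Complex.exp (-(t ^ 2 / 2)) := by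
  have h := charFun_gaussianReal (μ := 0) (v := 1) t
  rw [charFun_apply_real] at h
  simpa using h

lemma integrable_cexp_I_gaussian (t x : ℝ) :
    Integrable (fun z : ℝ => Complex.exp (t * (x + z) * Complex.I)) (gaussianReal 0 1) := by
  refine Integrable.of_bound (C := 1) (by fun_prop) (.of_forall fun z => ?_)
  have : (t * (x + z) * Complex.I : ℂ) = ((t * (x + z) : ℝ) : ℂ) * Complex.I := by push_cast; ring
  rw [this, Complex.norm_exp_ofReal_mul_I]

/-- The deconvolved kernel is a Gaussian average of squares of Dirichlet sums over a vertical
line, which is what makes it amenable to Parseval's identity. -/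
lemma deconvFejer_eq_integral (K : ℕ) (σ x : ℝ) :
    deconvFejer K σ x = (1 / (2 * K + 1) ^ 2 : ℂ) *
      ∫ t, dirichletSum K (σ * t) x ^ 2 ∂gaussianReal 0 1 := by
  rw [deconvFejer]
  congr 1
  have hterm : ∀ (m : ℤ) (t : ℝ), Complex.exp (m * ((σ * t : ℝ) : ℂ))
      = Complex.exp (((m * σ : ℝ) : ℂ) * t) := by
    intro m t; push_cast; congr 1; ring
  simp_rw [dirichletSum_sq, hterm]
  have hint : ∀ m : ℤ, Integrable (fun t : ℝ => Complex.exp (((m * σ : ℝ) : ℂ) * t)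
      * Complex.exp (m * x * Complex.I)) (gaussianReal 0 1) :=
    fun m => (integrable_cexp_mul_gaussian _).mul_const _
  rw [integral_finsetSum _ fun k _ => integrable_finsetSum _ fun l _ => hint (k + l)]
  refine Finset.sum_congr rfl fun k _ => ?_
  rw [integral_finsetSum _ fun l _ => hint (k + l)]
  refine Finset.sum_congr rfl fun l _ => ?_
  rw [integral_mul_const, integral_cexp_mul_gaussian]
  push_cast
  rfl

lemma integrable_norm_sq_dirichletSum (K : ℕ) (σ x : ℝ) :
    Integrable (fun t => ‖dirichletSum K (σ * t) x‖ ^ 2) (gaussianReal 0 1) := by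
  have h : Integrable (fun t => dirichletSum K (σ * t) x ^ 2) (gaussianReal 0 1) := by
    simp_rw [dirichletSum_sq]
    refine integrable_finsetSum _ fun k _ => integrable_finsetSum _ fun l _ => ?_
    have hterm : ∀ t : ℝ, Complex.exp (((k + l : ℤ) : ℂ) * ((σ * t : ℝ) : ℂ))
        = Complex.exp ((((k + l : ℤ) * σ : ℝ) : ℂ) * t) := by
      intro t; push_cast; congr 1; ring
    simp_rw [hterm]
    exact (integrable_cexp_mul_gaussian _).mul_const _
  simpa [norm_pow] using h.norm

/-- The deconvolved kernels centred at all points of a grid have a total size governed only by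
the top frequency: no factor of the number of frequencies is lost. -/
lemma sum_norm_deconvFejer_le {M K : ℕ} (hM : 2 * K < M) (σ x : ℝ) :
    ∑ b ∈ Finset.range M, ‖deconvFejer K σ (x - 2 * Real.pi * b / M)‖
      ≤ M / (2 * K + 1) * Real.exp (2 * (σ * K) ^ 2) := by
  have hN : (0 : ℝ) < 2 * K + 1 := by positivity
  have h1 : ∀ b : ℕ, ‖deconvFejer K σ (x - 2 * Real.pi * b / M)‖
      ≤ (1 / (2 * K + 1) ^ 2 : ℝ) *
        ∫ t, ‖dirichletSum K (σ * t) (x - 2 * Real.pi * b / M)‖ ^ 2 ∂gaussianReal 0 1 := by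
    intro b
    rw [deconvFejer_eq_integral, norm_mul]
    have : ‖(1 / (2 * K + 1) ^ 2 : ℂ)‖ = (1 / (2 * K + 1) ^ 2 : ℝ) := by
      rw [show (1 / (2 * K + 1) ^ 2 : ℂ) = ((1 / (2 * K + 1) ^ 2 : ℝ) : ℂ) by push_cast; rfl,
        Complex.norm_real, Real.norm_of_nonneg (by positivity)]
    rw [this]
    refine mul_le_mul_of_nonneg_left ?_ (by positivity)
    refine (norm_integral_le_integral_norm _).trans_eq ?_
    simp_rw [norm_pow]
  refine (Finset.sum_le_sum fun b _ => h1 b).trans ?_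
  rw [← Finset.mul_sum, ← integral_finsetSum _ fun b _ => integrable_norm_sq_dirichletSum K σ _]
  have h2 : ∀ t : ℝ, ∑ b ∈ Finset.range M, ‖dirichletSum K (σ * t) (x - 2 * Real.pi * b / M)‖ ^ 2
      = M * ∑ k ∈ Finset.Icc (-K : ℤ) K, Real.exp (2 * k * σ * t) := by
    intro t
    have := sum_norm_sq_grid hM (fun k => Complex.exp (k * ((σ * t : ℝ) : ℂ))) x
    simp only [dirichletSum]
    push_cast at this ⊢
    rw [this]
    congr 1
    refine Finset.sum_congr rfl fun k _ => ?_
    rw [Complex.norm_exp, ← Real.exp_nat_mul]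
    congr 1
    have : (k * (σ * t) : ℂ) = ((k * (σ * t) : ℝ) : ℂ) := by push_cast; rfl
    rw [this, Complex.ofReal_re]
    push_cast
    ring
  simp_rw [h2]
  rw [integral_const_mul, integral_finsetSum _ fun k _ => integrable_exp_mul_gaussianReal _]
  simp_rw [integral_exp_mul_gaussian]
  have h3 : ∑ k ∈ Finset.Icc (-K : ℤ) K, Real.exp ((2 * k * σ) ^ 2 / 2)
      ≤ (2 * K + 1) * Real.exp (2 * (σ * K) ^ 2) := by
    have hcard : ((Finset.Icc (-K : ℤ) K).card : ℝ) = 2 * K + 1 := by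
      rw [Int.card_Icc]
      have : ((K : ℤ) + 1 - -K).toNat = 2 * K + 1 := by omega
      rw [this]; push_cast; ring
    rw [← hcard, ← nsmul_eq_mul]
    refine Finset.sum_le_card_nsmul _ _ _ fun k hk => ?_
    rw [Finset.mem_Icc] at hk
    have hk' : (k : ℝ) ^ 2 ≤ (K : ℝ) ^ 2 := by
      have h1 : (-K : ℝ) ≤ k := by exact_mod_cast hk.1
      have h2 : (k : ℝ) ≤ K := by exact_mod_cast hk.2
      nlinarith
    refine Real.exp_le_exp.2 ?_
    nlinarith [mul_le_mul_of_nonneg_left hk' (sq_nonneg σ)]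
  calc _ ≤ (1 / (2 * K + 1) ^ 2 : ℝ) * (M * ((2 * K + 1) * Real.exp (2 * (σ * K) ^ 2))) := by gcongr
    _ = _ := by field_simp

/-- Gaussian smoothing of the deconvolved kernel is the Fejér kernel, written as the square of a
Dirichlet kernel. -/
lemma integral_deconvFejer_gaussian (K : ℕ) (σ x c : ℝ) :
    ∫ z, deconvFejer K σ (σ * (x + z) - c) ∂gaussianReal 0 1
      = (1 / (2 * K + 1) ^ 2 : ℂ) * dirichletSum K 0 (σ * x - c) ^ 2 := by
  simp_rw [deconvFejer]
  rw [integral_const_mul]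
  congr 1
  rw [dirichletSum_sq]
  have hterm : ∀ (m : ℤ) (z : ℝ), Complex.exp ((m * σ) ^ 2 / 2)
        * Complex.exp (m * ((σ * (x + z) - c : ℝ) : ℂ) * Complex.I)
      = Complex.exp ((m * σ) ^ 2 / 2) * Complex.exp (-(m * c * Complex.I))
        * Complex.exp (((m * σ : ℝ) : ℂ) * (x + z) * Complex.I) := by
    intro m z
    rw [mul_assoc (Complex.exp _) (Complex.exp _), ← Complex.exp_add (-(m * c * Complex.I))]
    congr 2
    push_cast
    ring
  simp_rw [hterm]
  have hint : ∀ m : ℤ, Integrable (fun z : ℝ => Complex.exp ((m * σ) ^ 2 / 2)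
        * Complex.exp (-(m * c * Complex.I))
        * Complex.exp (((m * σ : ℝ) : ℂ) * (x + z) * Complex.I)) (gaussianReal 0 1) :=
    fun m => (integrable_cexp_I_gaussian _ _).const_mul _
  rw [integral_finsetSum _ fun k _ => integrable_finsetSum _ fun l _ => hint (k + l)]
  refine Finset.sum_congr rfl fun k _ => ?_
  rw [integral_finsetSum _ fun l _ => hint (k + l)]
  refine Finset.sum_congr rfl fun l _ => ?_
  rw [integral_const_mul]
  generalize (k + l : ℤ) = m
  have hsplit : ∀ z : ℝ, Complex.exp (((m * σ : ℝ) : ℂ) * (x + z) * Complex.I)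
      = Complex.exp (((m * σ : ℝ) : ℂ) * x * Complex.I)
        * Complex.exp (((m * σ : ℝ) : ℂ) * z * Complex.I) := by
    intro z; rw [← Complex.exp_add]; congr 1; ring
  simp_rw [hsplit]
  rw [integral_const_mul, integral_cexp_I_gaussian, ← Complex.exp_add, ← Complex.exp_add,
    ← Complex.exp_add, ← Complex.exp_add]
  congr 1
  push_cast
  ring

lemma integrable_deconvFejer_gaussian (K : ℕ) (σ x c : ℝ) :
    Integrable (fun z => deconvFejer K σ (σ * (x + z) - c)) (gaussianReal 0 1) := by
  simp_rw [deconvFejer]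
  refine (integrable_finsetSum _ fun k _ => integrable_finsetSum _ fun l _ =>
    Integrable.const_mul ?_ _).const_mul _
  refine Integrable.of_bound (C := 1) (by fun_prop) (.of_forall fun z => ?_)
  have : (((k + l : ℤ) : ℂ) * ((σ * (x + z) - c : ℝ) : ℂ) * Complex.I : ℂ)
      = (((k + l : ℤ) * (σ * (x + z) - c) : ℝ) : ℂ) * Complex.I := by push_cast; ring
  rw [this, Complex.norm_exp_ofReal_mul_I]

lemma continuous_deconvFejer (K : ℕ) (σ : ℝ) : Continuous (deconvFejer K σ) := by
  unfold deconvFejer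
  fun_prop

lemma integral_character_period {A : ℝ} (hA : 0 < A) (m : ℤ) (c : ℝ) :
    ∫ y in (-A)..A, Complex.exp (m * ((Real.pi / A * y - c : ℝ) : ℂ) * Complex.I)
      = if m = 0 then ((2 * A : ℝ) : ℂ) else 0 := by
  split_ifs with h
  · subst h
    simp
    ring
  have hA' : (A : ℂ) ≠ 0 := by exact_mod_cast hA.ne'
  have hpi : (Real.pi : ℂ) ≠ 0 := by exact_mod_cast Real.pi_ne_zero
  have hm : (m : ℂ) ≠ 0 := by exact_mod_cast h
  have hterm : ∀ y : ℝ, Complex.exp (m * ((Real.pi / A * y - c : ℝ) : ℂ) * Complex.I)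
      = Complex.exp (-(m * c * Complex.I)) * Complex.exp ((m * (Real.pi / A) * Complex.I) * y) := by
    intro y; rw [← Complex.exp_add]; congr 1; push_cast; ring
  simp_rw [hterm]
  rw [intervalIntegral.integral_const_mul, integral_exp_mul_complex (by
    simp [hm, hpi, hA', Complex.I_ne_zero])]
  have h1 : Complex.exp (m * (Real.pi / A) * Complex.I * (A : ℝ))
      = Complex.exp (m * (Real.pi / A) * Complex.I * ((-A : ℝ) : ℂ)) := by
    rw [Complex.exp_eq_exp_iff_exists_int]
    refine ⟨m, ?_⟩
    push_cast
    field_simp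
    ring
  rw [h1]
  simp

lemma integral_deconvFejer_period {A : ℝ} (hA : 0 < A) (K : ℕ) (c : ℝ) :
    ∫ y in (-A)..A, deconvFejer K (Real.pi / A) (Real.pi / A * y - c)
      = ((2 * A / (2 * K + 1) : ℝ) : ℂ) := by
  simp_rw [deconvFejer]
  rw [intervalIntegral.integral_const_mul]
  rw [intervalIntegral.integral_finsetSum fun k _ => Continuous.intervalIntegrable (by fun_prop) _ _]
  have hk : ∀ k ∈ Finset.Icc (-K : ℤ) K, ∫ y in (-A)..A, ∑ l ∈ Finset.Icc (-K : ℤ) K,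
      Complex.exp (((k + l : ℤ) * ((Real.pi / A : ℝ) : ℂ)) ^ 2 / 2)
        * Complex.exp ((k + l : ℤ) * ((Real.pi / A * y - c : ℝ) : ℂ) * Complex.I)
      = ((2 * A : ℝ) : ℂ) := by
    intro k hk
    rw [intervalIntegral.integral_finsetSum
      fun l _ => Continuous.intervalIntegrable (by fun_prop) _ _]
    simp_rw [intervalIntegral.integral_const_mul, integral_character_period hA]
    rw [Finset.sum_eq_single (-k)]
    · simp
    · intro l _ hl
      rw [if_neg (by omega), mul_zero]
    · intro hk'
      simp only [Finset.mem_Icc] at hk hk'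
      omega
  rw [Finset.sum_congr rfl hk, Finset.sum_const, Int.card_Icc]
  have : ((K : ℤ) + 1 - -K).toNat = 2 * K + 1 := by omega
  rw [this, nsmul_eq_mul]
  have : (2 * K + 1 : ℂ) ≠ 0 := by exact_mod_cast (by omega : 2 * K + 1 ≠ 0)
  push_cast
  field_simp

lemma dirichletSum_zero (K : ℕ) (x : ℝ) : dirichletSum K 0 x
    = ∑ k ∈ Finset.Icc (-K : ℤ) K, Complex.exp (((k * x : ℝ) : ℂ) * Complex.I) := by
  refine Finset.sum_congr rfl fun k _ => ?_
  push_cast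
  simp

lemma dirichletSum_zero_im (K : ℕ) (x : ℝ) : (dirichletSum K 0 x).im = 0 := by
  simp only [dirichletSum_zero, Complex.im_sum, Complex.exp_ofReal_mul_I_im]
  have h := Finset.sum_nbij' (s := Finset.Icc (-K : ℤ) K) (t := Finset.Icc (-K : ℤ) K)
    (f := fun k : ℤ => Real.sin (k * x)) (g := fun k : ℤ => -Real.sin (k * x))
    (fun k => -k) (fun k => -k)
    (by intro k; simp only [Finset.mem_Icc]; omega)
    (by intro k; simp only [Finset.mem_Icc]; omega) (by simp) (by simp) (by
      intro k _; simp)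
  rw [Finset.sum_neg_distrib] at h
  linarith

lemma dirichletSum_zero_sq_re (K : ℕ) (x : ℝ) :
    (dirichletSum K 0 x ^ 2).re = (dirichletSum K 0 x).re ^ 2 := by
  rw [sq, Complex.mul_re, dirichletSum_zero_im]
  ring

lemma dirichletSum_zero_re_ge (K : ℕ) (x : ℝ) (hx : |x| ≤ Real.pi / (4 * (2 * K + 1))) :
    9 / 10 * (2 * K + 1) ≤ (dirichletSum K 0 x).re := by
  have hcard : (Finset.Icc (-K : ℤ) K).card = 2 * K + 1 := by rw [Int.card_Icc]; omega
  simp only [dirichletSum_zero, Complex.re_sum, Complex.exp_ofReal_mul_I_re]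
  -- every term is at least `cos (π / 8) ≥ 9 / 10`
  have h : ∀ k ∈ Finset.Icc (-K : ℤ) K, (9 / 10 : ℝ) ≤ Real.cos (k * x) := by
    intro k hk
    rw [Finset.mem_Icc] at hk
    have hk1 : |(k : ℝ)| ≤ K := by
      rw [abs_le]; exact ⟨by exact_mod_cast hk.1, by exact_mod_cast hk.2⟩
    have hN : (0 : ℝ) < 2 * K + 1 := by positivity
    have h1 : |(k : ℝ) * x| ≤ Real.pi / 8 := by
      rw [abs_mul]
      calc |(k : ℝ)| * |x| ≤ K * (Real.pi / (4 * (2 * K + 1))) := by gcongr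
        _ ≤ Real.pi / 8 := by
          rw [mul_div_assoc', div_le_div_iff₀ (by positivity) (by norm_num)]
          nlinarith [Real.pi_pos]
    have h2 := Real.one_sub_sq_div_two_le_cos (x := (k : ℝ) * x)
    have h3 : ((k : ℝ) * x) ^ 2 ≤ (2 / 5) ^ 2 := by
      rw [← sq_abs]
      have := Real.pi_lt_d2
      gcongr
      linarith
    linarith
  have := Finset.card_nsmul_le_sum _ _ _ h
  rw [hcard, nsmul_eq_mul] at this
  push_cast at this
  linarith

/-! ### The test function -/

/-- `⌊u⌋`, except at the right end point `u = M`, which belongs to the last bin. -/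
lemma exists_nat_bin {M : ℕ} (hM : 0 < M) {u : ℝ} (h0 : 0 ≤ u) (h1 : u ≤ M) :
    ∃ b < M, (b : ℝ) ≤ u ∧ u ≤ b + 1 := by
  rcases h1.lt_or_eq with h | h
  · exact ⟨⌊u⌋₊, (Nat.floor_lt h0).2 h, Nat.floor_le h0, (Nat.lt_floor_add_one u).le⟩
  · refine ⟨M - 1, by omega, ?_, ?_⟩ <;> rw [h, Nat.cast_sub hM] <;> simp

/-- For `K` points of `[-A, A]` there is a bounded test function whose Gaussian smoothing is
nonpositive at each of the points although its mean over `[-A, A]` is bounded below. The circle of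
length `2A` is cut into `4 (2K + 1)` bins; from the constant `1` one subtracts a multiple of the
deconvolved Fejér kernel centred at each bin that contains one of the points. -/
theorem exists_testFunction {A : ℝ} (hA : 0 < A) (s : Finset ℝ) (hs : ∀ x ∈ s, |x| ≤ A) :
    ∃ g : ℝ → ℝ, Continuous g ∧
      (∀ y, |g y| ≤ 6 * Real.exp (2 * (Real.pi * s.card / A) ^ 2)) ∧
      (∀ x ∈ s, ∫ z, g (x + z) ∂gaussianReal 0 1 ≤ 0) ∧
      3 / 8 * (2 * A) ≤ ∫ y in (-A)..A, g y := by
  classical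
  set K := s.card with hK
  set σ := Real.pi / A with hσ
  set M := 4 * (2 * K + 1) with hM
  have hM0 : 0 < M := by omega
  have hMr : (M : ℝ) = 4 * (2 * K + 1) := by rw [hM]; push_cast; ring
  have hMpos : (0 : ℝ) < M := by exact_mod_cast hM0
  have hNpos : (0 : ℝ) < 2 * K + 1 := by positivity
  have hpi := Real.pi_pos
  -- `c b` is the centre of the `b`-th of `M` bins of half-width `π / M` that cover `[-π, π]`
  let c : ℕ → ℝ := fun b => -Real.pi + Real.pi / M + 2 * Real.pi * b / M
  have hbin : ∀ x : ℝ, ∃ b < M, |x| ≤ A → |σ * x - c b| ≤ Real.pi / M := by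
    intro x
    by_cases hx : |x| ≤ A
    · rw [abs_le] at hx
      have hu0 : 0 ≤ (σ * x + Real.pi) * M / (2 * Real.pi) := by
        have : 0 ≤ σ * x + Real.pi := by
          rw [hσ, div_mul_eq_mul_div, div_add' _ _ _ hA.ne']
          refine div_nonneg ?_ hA.le
          nlinarith
        positivity
      have hu1 : (σ * x + Real.pi) * M / (2 * Real.pi) ≤ M := by
        have : σ * x ≤ Real.pi := by
          rw [hσ, div_mul_eq_mul_div, div_le_iff₀ hA]
          nlinarith
        rw [div_le_iff₀ (by positivity)]
        nlinarith
      obtain ⟨b, hb, h1, h2⟩ := exists_nat_bin hM0 hu0 hu1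
      refine ⟨b, hb, fun _ => ?_⟩
      rw [le_div_iff₀ (by positivity)] at h1
      rw [div_le_iff₀ (by positivity)] at h2
      have h3 : σ * x - c b = ((σ * x + Real.pi) * M - Real.pi - 2 * Real.pi * b) / M := by
        simp only [c]; field_simp; ring
      rw [h3, abs_div, abs_of_pos hMpos]
      gcongr
      rw [abs_le]
      constructor <;> linarith
    · exact ⟨0, hM0, fun h => absurd h hx⟩
  choose β hβM hβ using hbin
  set S := s.image β with hS
  have hSK : (S.card : ℝ) ≤ K := by exact_mod_cast Finset.card_image_le
  have hSM : S ⊆ Finset.range M := by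
    intro b hb
    obtain ⟨x, -, rfl⟩ := Finset.mem_image.1 hb
    exact Finset.mem_range.2 (hβM x)
  -- on its own bin the Fejér kernel is at least `(9 / 10)²`, and `5 / 4 * (9 / 10)² > 1`, while
  -- the means of the subtracted kernels add up to at most `5 / 4 * K / (2K + 1) < 5 / 8`
  refine ⟨fun y => 1 - 5 / 4 * ∑ b ∈ S, (deconvFejer K σ (σ * y - c b)).re, ?_, ?_, ?_, ?_⟩
  · have := continuous_deconvFejer K σ
    fun_prop
  · intro y
    have h1 : |∑ b ∈ S, (deconvFejer K σ (σ * y - c b)).re| ≤ 4 * Real.exp (2 * (σ * K) ^ 2) := by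
      calc |∑ b ∈ S, (deconvFejer K σ (σ * y - c b)).re|
          ≤ ∑ b ∈ S, |(deconvFejer K σ (σ * y - c b)).re| := Finset.abs_sum_le_sum_abs _ _
        _ ≤ ∑ b ∈ S, ‖deconvFejer K σ (σ * y - c b)‖ :=
            Finset.sum_le_sum fun b _ => Complex.abs_re_le_norm _
        _ ≤ ∑ b ∈ Finset.range M, ‖deconvFejer K σ (σ * y - c b)‖ :=
            Finset.sum_le_sum_of_subset_of_nonneg hSM fun _ _ _ => norm_nonneg _
        _ ≤ M / (2 * K + 1) * Real.exp (2 * (σ * K) ^ 2) := by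
            have := sum_norm_deconvFejer_le (M := M) (K := K) (by omega) σ
              (σ * y + Real.pi - Real.pi / M)
            convert this using 4 with b
            simp only [c]; ring
        _ = 4 * Real.exp (2 * (σ * K) ^ 2) := by
            rw [hMr]; field_simp
    have h2 : 1 ≤ Real.exp (2 * (σ * K) ^ 2) := Real.one_le_exp (by positivity)
    have h3 : Real.pi * K / A = σ * K := by rw [hσ]; ring
    rw [h3]
    rw [abs_le] at h1 ⊢
    constructor <;> linarith
  · intro x hx
    have hint : ∀ b, Integrable (fun z => (deconvFejer K σ (σ * (x + z) - c b)).re)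
        (gaussianReal 0 1) := fun b => (integrable_deconvFejer_gaussian K σ x (c b)).re
    have hval : ∀ b, ∫ z, (deconvFejer K σ (σ * (x + z) - c b)).re ∂gaussianReal 0 1
        = 1 / (2 * K + 1) ^ 2 * (dirichletSum K 0 (σ * x - c b)).re ^ 2 := by
      intro b
      have h := integral_re (integrable_deconvFejer_gaussian K σ x (c b))
      simp only [RCLike.re_to_complex] at h
      rw [h, integral_deconvFejer_gaussian, ← dirichletSum_zero_sq_re]
      rw [show (1 / (2 * K + 1) ^ 2 : ℂ) = ((1 / (2 * K + 1) ^ 2 : ℝ) : ℂ) by push_cast; rfl,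
        Complex.re_ofReal_mul]
    rw [integral_sub (integrable_const _)
      ((integrable_finsetSum _ fun b _ => hint b).const_mul _), integral_const_mul,
      integral_finsetSum _ fun b _ => hint b]
    simp_rw [hval]
    have hmem : β x ∈ S := Finset.mem_image_of_mem _ hx
    have h1 := Finset.single_le_sum (f := fun b => 1 / (2 * K + 1 : ℝ) ^ 2
      * (dirichletSum K 0 (σ * x - c b)).re ^ 2) (fun b _ => by positivity) hmem
    have h2 := dirichletSum_zero_re_ge K (σ * x - c (β x)) (by
      have := hβ x (hs x hx)
      rwa [hMr] at this)
    have h3 : (9 / 10 : ℝ) ^ 2 ≤ 1 / (2 * K + 1 : ℝ) ^ 2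
        * (dirichletSum K 0 (σ * x - c (β x))).re ^ 2 := by
      rw [one_div_mul_eq_div, le_div_iff₀ (by positivity), ← mul_pow]
      gcongr
    simp only [integral_const, probReal_univ, smul_eq_mul]
    linarith
  · have hcont := continuous_deconvFejer K σ
    have hint : ∀ b, ∫ y in (-A)..A, (deconvFejer K σ (σ * y - c b)).re = 2 * A / (2 * K + 1) := by
      intro b
      have h := integral_deconvFejer_period hA K (c b)
      rw [intervalIntegral.integral_of_le (by linarith)] at h ⊢
      have h2 := integral_re (μ := volume.restrict (Set.Ioc (-A) A))
        (f := fun y => deconvFejer K σ (σ * y - c b))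
        (Continuous.integrableOn_Ioc (by fun_prop))
      simp only [RCLike.re_to_complex] at h2
      rw [h2, h, Complex.ofReal_re]
    rw [intervalIntegral.integral_sub (by simp) (Continuous.intervalIntegrable (by fun_prop) _ _),
      intervalIntegral.integral_const_mul, intervalIntegral.integral_finsetSum
        fun b _ => Continuous.intervalIntegrable (by fun_prop) _ _]
    simp_rw [hint]
    rw [Finset.sum_const, nsmul_eq_mul, intervalIntegral.integral_const, smul_eq_mul]
    have h1 : (S.card : ℝ) * (2 * A / (2 * K + 1)) ≤ A := by
      rw [mul_div_assoc', div_le_iff₀ hNpos]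
      nlinarith
    linarith

/-! ### The output law and the mutual information -/

/-- The density of the channel output `Y = X + Z` when `X` has law `P`. -/
noncomputable def outputDensity (P : Measure ℝ) (y : ℝ) : ℝ := ∫ x, gaussianPDFReal x 1 y ∂P

/-- The law of the channel output `Y = X + Z` when `X` has law `P`. -/
noncomputable def outputLaw (P : Measure ℝ) : Measure ℝ :=
  (P.prod (gaussianReal 0 1)).map (fun p => p.1 + p.2)

lemma gaussianPDFReal_one_eq (x y : ℝ) :
    gaussianPDFReal x 1 y = (√(2 * Real.pi))⁻¹ * Real.exp (-(y - x) ^ 2 / 2) := by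
  simp [gaussianPDFReal]

lemma gaussianPDFReal_one_le (x y : ℝ) : gaussianPDFReal x 1 y ≤ (√(2 * Real.pi))⁻¹ := by
  rw [gaussianPDFReal_one_eq]
  refine mul_le_of_le_one_right (by positivity) (Real.exp_le_one_iff.2 ?_)
  nlinarith [sq_nonneg (y - x)]

lemma log_gaussianPDFReal_one (x y : ℝ) :
    Real.log (gaussianPDFReal x 1 y) = -(Real.log (2 * Real.pi) / 2) - (y - x) ^ 2 / 2 := by
  rw [gaussianPDFReal_one_eq, Real.log_mul (by positivity) (Real.exp_pos _).ne', Real.log_exp,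
    Real.log_inv, Real.log_sqrt (by positivity)]
  ring

lemma measurable_gaussianPDFReal_prod :
    Measurable (fun p : ℝ × ℝ => gaussianPDFReal p.1 1 p.2) := by
  simp only [gaussianPDFReal_one_eq]
  fun_prop

lemma measurable_gaussianPDF_prod : Measurable (fun p : ℝ × ℝ => gaussianPDF p.1 1 p.2) :=
  measurable_gaussianPDFReal_prod.ennreal_ofReal

lemma inputOutputLaw_eq_withDensity (P : Measure ℝ) [SFinite P] :
    inputOutputLaw P = (P.prod volume).withDensity (fun p => gaussianPDF p.1 1 p.2) := by
  ext s hs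
  have hm : Measurable (fun p : ℝ × ℝ => (p.1, p.1 + p.2)) := by fun_prop
  rw [inputOutputLaw, Measure.map_apply hm hs, Measure.prod_apply (hm hs),
    withDensity_apply _ hs, ← lintegral_indicator hs,
    lintegral_prod _ (measurable_gaussianPDF_prod.indicator hs).aemeasurable]
  refine lintegral_congr fun x => ?_
  have hsx : MeasurableSet (Prod.mk x ⁻¹' s) := measurable_prodMk_left hs
  have h1 : Prod.mk x ⁻¹' ((fun p : ℝ × ℝ => (p.1, p.1 + p.2)) ⁻¹' s)
      = (fun z => x + z) ⁻¹' (Prod.mk x ⁻¹' s) := rfl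
  rw [h1, ← Measure.map_apply (by fun_prop) hsx, gaussianReal_map_const_add, zero_add,
    gaussianReal_apply _ one_ne_zero, ← lintegral_indicator hsx]
  rfl

lemma fst_inputOutputLaw (P : Measure ℝ) [SFinite P] : (inputOutputLaw P).fst = P := by
  rw [Measure.fst, inputOutputLaw, Measure.map_map (by fun_prop) (by fun_prop)]
  have : Prod.fst ∘ (fun p : ℝ × ℝ => (p.1, p.1 + p.2)) = Prod.fst := rfl
  rw [this]
  exact Measure.fst_prod

lemma snd_inputOutputLaw (P : Measure ℝ) : (inputOutputLaw P).snd = outputLaw P := by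
  rw [Measure.snd, inputOutputLaw, Measure.map_map (by fun_prop) (by fun_prop)]
  rfl

section Output

variable {P : Measure ℝ} [IsProbabilityMeasure P]

lemma integrable_gaussianPDFReal_input (y : ℝ) :
    Integrable (fun x => gaussianPDFReal x 1 y) P := by
  refine Integrable.of_bound (C := (√(2 * Real.pi))⁻¹)
    (measurable_gaussianPDFReal_prod.comp measurable_prodMk_right).aestronglyMeasurable
    (.of_forall fun x => ?_)
  rw [Real.norm_of_nonneg (gaussianPDFReal_nonneg _ _ _)]
  exact gaussianPDFReal_one_le x y

lemma outputDensity_pos (y : ℝ) : 0 < outputDensity P y := by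
  rw [outputDensity, integral_pos_iff_support_of_nonneg
    (fun x => gaussianPDFReal_nonneg x 1 y) (integrable_gaussianPDFReal_input y)]
  have : Function.support (fun x => gaussianPDFReal x 1 y) = Set.univ := by
    ext x
    simpa using (gaussianPDFReal_pos x 1 y one_ne_zero).ne'
  rw [this]
  simp

lemma outputDensity_le_one (y : ℝ) : outputDensity P y ≤ 1 := by
  have h1 : (√(2 * Real.pi))⁻¹ ≤ 1 := by
    refine inv_le_one_of_one_le₀ (Real.one_le_sqrt.2 ?_)
    linarith [Real.pi_gt_three]
  calc outputDensity P y ≤ ∫ _, (1 : ℝ) ∂P :=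
        integral_mono (integrable_gaussianPDFReal_input y) (integrable_const _)
          fun x => (gaussianPDFReal_one_le x y).trans h1
    _ = 1 := by simp

lemma le_outputDensity {A : ℝ} (hP : ∀ᵐ x ∂P, |x| ≤ A) (y : ℝ) :
    (√(2 * Real.pi))⁻¹ * Real.exp (-(|y| + A) ^ 2 / 2) ≤ outputDensity P y := by
  calc (√(2 * Real.pi))⁻¹ * Real.exp (-(|y| + A) ^ 2 / 2)
      = ∫ _, (√(2 * Real.pi))⁻¹ * Real.exp (-(|y| + A) ^ 2 / 2) ∂P := by simp
    _ ≤ outputDensity P y := by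
      refine integral_mono_ae (integrable_const _) (integrable_gaussianPDFReal_input y) ?_
      filter_upwards [hP] with x hx
      rw [gaussianPDFReal_one_eq]
      have h : |y - x| ≤ |y| + A := (abs_sub y x).trans (by linarith)
      have h2 : (y - x) ^ 2 ≤ (|y| + A) ^ 2 := by
        rw [← sq_abs (y - x)]; gcongr
      gcongr

lemma measurable_outputDensity : Measurable (outputDensity P) :=
  StronglyMeasurable.measurable <| StronglyMeasurable.integral_prod_right
    (f := fun y x => gaussianPDFReal x 1 y)
    (measurable_gaussianPDFReal_prod.comp measurable_swap).stronglyMeasurable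

lemma ofReal_outputDensity (y : ℝ) :
    ENNReal.ofReal (outputDensity P y) = ∫⁻ x, gaussianPDF x 1 y ∂P :=
  ofReal_integral_eq_lintegral_ofReal (integrable_gaussianPDFReal_input y)
    (.of_forall fun x => gaussianPDFReal_nonneg x 1 y)

instance : IsProbabilityMeasure (inputOutputLaw P) :=
  Measure.isProbabilityMeasure_map (by fun_prop)

instance : IsProbabilityMeasure (outputLaw P) :=
  Measure.isProbabilityMeasure_map (by fun_prop)

lemma outputLaw_eq_withDensity :
    outputLaw P = volume.withDensity (fun y => ENNReal.ofReal (outputDensity P y)) := by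
  ext s hs
  rw [← snd_inputOutputLaw, Measure.snd_apply hs, inputOutputLaw_eq_withDensity,
    withDensity_apply _ (measurable_snd hs), withDensity_apply _ hs,
    ← lintegral_indicator (measurable_snd hs), lintegral_prod_symm _
      (measurable_gaussianPDF_prod.indicator (measurable_snd hs)).aemeasurable,
    ← lintegral_indicator hs]
  refine lintegral_congr fun y => ?_
  by_cases hy : y ∈ s
  · rw [Set.indicator_of_mem hy, ofReal_outputDensity]
    exact lintegral_congr fun x => Set.indicator_of_mem (s := Prod.snd ⁻¹' s) hy _
  · rw [Set.indicator_of_notMem hy]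
    have : ∀ x : ℝ, (Prod.snd ⁻¹' s : Set (ℝ × ℝ)).indicator
        (fun p => gaussianPDF p.1 1 p.2) (x, y) = 0 :=
      fun x => Set.indicator_of_notMem (s := Prod.snd ⁻¹' s) hy _
    simp [this]

lemma integrable_outputLaw_iff {F : ℝ → ℝ} :
    Integrable F (outputLaw P) ↔ Integrable (fun y => outputDensity P y * F y) := by
  rw [outputLaw_eq_withDensity, integrable_withDensity_iff_integrable_smul'
    measurable_outputDensity.ennreal_ofReal (by simp)]
  simp [ENNReal.toReal_ofReal (outputDensity_pos _).le]

lemma integral_outputLaw (F : ℝ → ℝ) :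
    ∫ y, F y ∂outputLaw P = ∫ y, outputDensity P y * F y := by
  rw [outputLaw_eq_withDensity, integral_withDensity_eq_integral_toReal_smul
    measurable_outputDensity.ennreal_ofReal (by simp)]
  simp [ENNReal.toReal_ofReal (outputDensity_pos _).le]

lemma integral_outputLaw_eq_prod {F : ℝ → ℝ} (hF : Integrable F (outputLaw P)) :
    ∫ y, F y ∂outputLaw P = ∫ x, ∫ z, F (x + z) ∂gaussianReal 0 1 ∂P := by
  have hm : AEMeasurable (fun p : ℝ × ℝ => p.1 + p.2) (P.prod (gaussianReal 0 1)) := by fun_prop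
  rw [outputLaw, integral_map hm hF.aestronglyMeasurable]
  exact integral_prod _ ((integrable_map_measure hF.aestronglyMeasurable hm).1 hF)

lemma integrable_outputDensity : Integrable (outputDensity P) := by
  have h := (integrable_outputLaw_iff (P := P) (F := fun _ => 1)).1 (integrable_const _)
  simpa using h

lemma integral_outputDensity : ∫ y, outputDensity P y = 1 := by
  have h := integral_outputLaw (P := P) (fun _ => 1)
  simpa using h.symm

lemma integrable_sq_gaussian : Integrable (fun z : ℝ => z ^ 2) (gaussianReal 0 1) := by
  have := (memLp_id_gaussianReal (μ := 0) (v := 1) 2).integrable_sq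
  simpa using this

lemma integral_sq_gaussian : ∫ z, z ^ 2 ∂gaussianReal 0 1 = 1 := by
  have h := variance_fun_id_gaussianReal (μ := 0) (v := 1)
  rw [variance_of_integral_eq_zero (by fun_prop) (by simp)] at h
  simpa using h

lemma integrable_sq_outputLaw {A : ℝ} (hP : ∀ᵐ x ∂P, |x| ≤ A) :
    Integrable (fun y : ℝ => y ^ 2) (outputLaw P) := by
  have hm : AEMeasurable (fun p : ℝ × ℝ => p.1 + p.2) (P.prod (gaussianReal 0 1)) := by fun_prop
  rw [outputLaw, integrable_map_measure (by fun_prop) hm]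
  have hdom : Integrable (fun p : ℝ × ℝ => 2 * A ^ 2 + 2 * p.2 ^ 2)
      (P.prod (gaussianReal 0 1)) :=
    (integrable_const _).add ((integrable_sq_gaussian.comp_snd P).const_mul 2)
  refine hdom.mono' (by fun_prop) ?_
  have hP' : ∀ᵐ p ∂P.prod (gaussianReal 0 1), |p.1| ≤ A :=
    Measure.quasiMeasurePreserving_fst.ae hP
  filter_upwards [hP'] with p hp
  have h1 : p.1 ^ 2 ≤ A ^ 2 := by rw [← sq_abs]; gcongr
  simp only [Function.comp_apply]
  rw [Real.norm_of_nonneg (sq_nonneg _)]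
  nlinarith [sq_nonneg (p.1 - p.2)]

lemma integrable_outputLaw_of_le {A a b : ℝ} (hP : ∀ᵐ x ∂P, |x| ≤ A) {F : ℝ → ℝ}
    (hm : Measurable F) (hF : ∀ y, |F y| ≤ a + b * y ^ 2) : Integrable F (outputLaw P) :=
  ((integrable_const a).add ((integrable_sq_outputLaw hP).const_mul b)).mono'
    hm.aestronglyMeasurable (.of_forall hF)

lemma integrable_log_outputDensity {A : ℝ} (hP : ∀ᵐ x ∂P, |x| ≤ A) :
    Integrable (fun y => Real.log (outputDensity P y)) (outputLaw P) := by
  refine integrable_outputLaw_of_le (a := Real.log (2 * Real.pi) / 2 + A ^ 2) (b := 1) hP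
    (Real.measurable_log.comp measurable_outputDensity) fun y => ?_
  have h1 : Real.log (outputDensity P y) ≤ 0 :=
    Real.log_nonpos (outputDensity_pos y).le (outputDensity_le_one y)
  have h2 := Real.log_le_log (by positivity) (le_outputDensity hP y)
  rw [Real.log_mul (by positivity) (Real.exp_pos _).ne', Real.log_exp,
    Real.log_inv, Real.log_sqrt (by positivity)] at h2
  rw [abs_of_nonpos h1]
  nlinarith [sq_nonneg (|y| - A), sq_abs y]

/-- For bounded inputs `I(X; Y) = h(Y) - h(Z)`, where `h(Z) = ½ log (2πe)`. -/
theorem channelInfo_eq {A : ℝ} (hP : ∀ᵐ x ∂P, |x| ≤ A) :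
    channelInfo P ≠ ∞ ∧ (channelInfo P).toReal
      = -(∫ y, Real.log (outputDensity P y) ∂outputLaw P)
        - (Real.log (2 * Real.pi) / 2 + 1 / 2) := by
  set ρ := P.prod (outputLaw P) with hρ
  have hfm : Measurable (fun p : ℝ × ℝ => ENNReal.ofReal (outputDensity P p.2)) :=
    measurable_outputDensity.ennreal_ofReal.comp measurable_snd
  have hD : inputOutputLaw P = ρ.withDensity
      (fun p => gaussianPDF p.1 1 p.2 / ENNReal.ofReal (outputDensity P p.2)) := by
    rw [hρ, outputLaw_eq_withDensity,
      prod_withDensity_right measurable_outputDensity.ennreal_ofReal,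
      inputOutputLaw_eq_withDensity]
    refine Eq.trans ?_ (withDensity_mul _ hfm (measurable_gaussianPDF_prod.div hfm))
    congr 1
    ext p
    simp only [Pi.mul_apply]
    rw [ENNReal.mul_div_cancel (by simpa using outputDensity_pos p.2) ENNReal.ofReal_ne_top]
  have hac : inputOutputLaw P ≪ ρ := by
    rw [hD]; exact withDensity_absolutelyContinuous _ _
  have hllr : llr (inputOutputLaw P) ρ =ᵐ[inputOutputLaw P] fun p =>
      (-(Real.log (2 * Real.pi) / 2) - (p.2 - p.1) ^ 2 / 2)
        - Real.log (outputDensity P p.2) := by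
    refine hac.ae_le ?_
    have h := Measure.rnDeriv_withDensity ρ (measurable_gaussianPDF_prod.div hfm)
    simp only [Pi.div_def] at h
    rw [← hD] at h
    filter_upwards [h] with p hp
    rw [llr, hp, ENNReal.toReal_div, ENNReal.toReal_ofReal (outputDensity_pos _).le,
      toReal_gaussianPDF, Real.log_div (gaussianPDFReal_pos _ _ _ one_ne_zero).ne'
        (outputDensity_pos _).ne', log_gaussianPDFReal_one]
  have hm : AEMeasurable (fun p : ℝ × ℝ => (p.1, p.1 + p.2)) (P.prod (gaussianReal 0 1)) := by
    fun_prop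
  have hI1 : Integrable (fun p : ℝ × ℝ => -(Real.log (2 * Real.pi) / 2) - (p.2 - p.1) ^ 2 / 2)
      (inputOutputLaw P) := by
    rw [inputOutputLaw, integrable_map_measure (by fun_prop) hm]
    simp only [Function.comp_def, add_sub_cancel_left]
    exact (integrable_const _).sub ((integrable_sq_gaussian.comp_snd P).div_const 2)
  have hv1 : ∫ p, (-(Real.log (2 * Real.pi) / 2) - (p.2 - p.1) ^ 2 / 2) ∂inputOutputLaw P
      = -(Real.log (2 * Real.pi) / 2) - 1 / 2 := by
    rw [inputOutputLaw, integral_map hm (by fun_prop)]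
    simp only [add_sub_cancel_left]
    rw [integral_sub (integrable_const _) ((integrable_sq_gaussian.comp_snd P).div_const 2),
      integral_div, integral_fun_snd (fun z : ℝ => z ^ 2), integral_sq_gaussian]
    simp
  have hmeas : AEStronglyMeasurable (fun y => Real.log (outputDensity P y)) (outputLaw P) :=
    (integrable_log_outputDensity hP).aestronglyMeasurable
  have hI2 : Integrable (fun p : ℝ × ℝ => Real.log (outputDensity P p.2)) (inputOutputLaw P) := by
    have h := integrable_log_outputDensity hP
    rw [← snd_inputOutputLaw] at h
    exact h.comp_measurable measurable_snd
  have hv2 : ∫ p, Real.log (outputDensity P p.2) ∂inputOutputLaw P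
      = ∫ y, Real.log (outputDensity P y) ∂outputLaw P := by
    rw [← snd_inputOutputLaw, Measure.snd, integral_map (by fun_prop)]
    rw [← Measure.snd, snd_inputOutputLaw]
    exact hmeas
  have hint : Integrable (llr (inputOutputLaw P) ρ) (inputOutputLaw P) :=
    (hI1.sub hI2).congr hllr.symm
  have hCI : channelInfo P = InformationTheory.klDiv (inputOutputLaw P) ρ := by
    rw [channelInfo, mutualInfo, fst_inputOutputLaw, snd_inputOutputLaw]
  rw [hCI]
  refine ⟨InformationTheory.klDiv_ne_top hac hint, ?_⟩
  rw [InformationTheory.toReal_klDiv_of_measure_eq hac (by simp), integral_congr_ae hllr,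
    integral_sub hI1 hI2, hv1, hv2]
  ring

end Output

lemma IsInput.ae_abs_le {A : ℝ} {P : Measure ℝ} (h : IsInput A P) : ∀ᵐ x ∂P, |x| ≤ A := by
  filter_upwards [Measure.support_mem_ae (μ := P)] with x hx
  exact abs_le.2 (h.2 hx)

/-- The uniform input shows that `C(A) ≥ log (2A) - h(Z)`: its output density is at most
`1 / (2A)`. -/
theorem log_sub_le_capacity {A : ℝ} (hA : 0 < A) :
    ENNReal.ofReal (Real.log (2 * A) - (Real.log (2 * Real.pi) / 2 + 1 / 2)) ≤ capacity A := by
  set U : Measure ℝ := cond volume (Set.Icc (-A) A) with hU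
  have hvol : volume (Set.Icc (-A) A) = ENNReal.ofReal (2 * A) := by
    rw [Real.volume_Icc]; congr 1; ring
  have hUp : IsProbabilityMeasure U := by
    refine cond_isProbabilityMeasure_of_finite ?_ ?_ <;> rw [hvol]
    · simpa using hA
    · exact ENNReal.ofReal_ne_top
  have hin : IsInput A U := by
    refine ⟨hUp, Measure.support_subset_of_isClosed isClosed_Icc ?_⟩
    exact ae_cond_mem measurableSet_Icc
  refine le_trans ?_ (le_iSup₂ (f := fun P (_ : IsInput A P) => channelInfo P) U hin)
  obtain ⟨hne, heq⟩ := channelInfo_eq (P := U) hin.ae_abs_le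
  rw [← ENNReal.ofReal_toReal hne, heq]
  refine ENNReal.ofReal_le_ofReal (sub_le_sub_right ?_ _)
  have hdens : ∀ y, outputDensity U y ≤ (2 * A)⁻¹ := by
    intro y
    have hsymm : (fun x => gaussianPDFReal x 1 y) = gaussianPDFReal y 1 := by
      ext x
      rw [gaussianPDFReal_one_eq, gaussianPDFReal_one_eq, ← neg_sub y x, neg_sq]
    have hint : Integrable (fun x => gaussianPDFReal x 1 y) := by
      rw [hsymm]
      exact integrable_gaussianPDFReal y 1
    have hone : ∫ x, gaussianPDFReal x 1 y = 1 := by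
      rw [hsymm]
      exact integral_gaussianPDFReal_eq_one y one_ne_zero
    rw [outputDensity, hU, ProbabilityTheory.cond, integral_smul_measure, hvol, ENNReal.toReal_inv,
      ENNReal.toReal_ofReal (by positivity), smul_eq_mul]
    refine mul_le_of_le_one_right (by positivity) ?_
    rw [← hone]
    exact setIntegral_le_integral hint (.of_forall fun x => gaussianPDFReal_nonneg _ _ _)
  have hlog : ∀ y, Real.log (outputDensity U y) ≤ -Real.log (2 * A) := by
    intro y
    rw [← Real.log_inv]
    exact Real.log_le_log (outputDensity_pos y) (hdens y)
  have := integral_mono (integrable_log_outputDensity hin.ae_abs_le)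
    (integrable_const (-Real.log (2 * A))) hlog
  simp only [integral_const, probReal_univ, smul_eq_mul, one_mul] at this
  linarith

/-- The output of a near-optimal input has differential entropy at least `log (2A) - ε`. -/
theorem IsNearOptimal.integral_log_outputDensity_le {A ε : ℝ} (hA : 0 < A) (hε : 0 ≤ ε)
    {P : Measure ℝ} (h : IsNearOptimal ε A P) :
    ∫ y, Real.log (outputDensity P y) ∂outputLaw P ≤ ε - Real.log (2 * A) := by
  have := h.1.1
  obtain ⟨hne, heq⟩ := channelInfo_eq (P := P) h.1.ae_abs_le
  have h1 := (log_sub_le_capacity hA).trans h.2.2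
  rw [← ENNReal.ofReal_toReal hne, ← ENNReal.ofReal_add ENNReal.toReal_nonneg hε,
    ENNReal.ofReal_le_ofReal_iff (add_nonneg ENNReal.toReal_nonneg hε), heq] at h1
  linarith

/-! ### The reference density -/

/-- `t² - 1` on the positive half-line and `0` elsewhere. -/
noncomputable def halfLineCost (t : ℝ) : ℝ := if 0 < t then t ^ 2 - 1 else 0

lemma measurable_halfLineCost : Measurable halfLineCost :=
  Measurable.ite measurableSet_Ioi (by fun_prop) measurable_const

lemma abs_halfLineCost_le (t : ℝ) : |halfLineCost t| ≤ 1 + t ^ 2 := by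
  unfold halfLineCost
  split_ifs
  · rw [abs_le]; constructor <;> nlinarith [sq_nonneg t]
  · simp; positivity

lemma integrable_halfLineCost_gaussian : Integrable halfLineCost (gaussianReal 0 1) :=
  ((integrable_const (1 : ℝ)).add integrable_sq_gaussian).mono'
    measurable_halfLineCost.aestronglyMeasurable (.of_forall abs_halfLineCost_le)

lemma integral_comp_neg_gaussian (F : ℝ → ℝ) (hF : Measurable F) :
    ∫ z, F (-z) ∂gaussianReal 0 1 = ∫ z, F z ∂gaussianReal 0 1 := by
  have h := gaussianReal_map_neg (μ := 0) (v := 1)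
  rw [neg_zero] at h
  conv_rhs => rw [← h]
  rw [integral_map (by fun_prop) hF.aestronglyMeasurable]

/-- By symmetry this is half of `E Z² - 1 = 0`. -/
lemma integral_halfLineCost_gaussian : ∫ z, halfLineCost z ∂gaussianReal 0 1 = 0 := by
  have h1 : ∫ z, (halfLineCost z + halfLineCost (-z)) ∂gaussianReal 0 1
      = ∫ z, (z ^ 2 - 1) ∂gaussianReal 0 1 := by
    have := nullSingletonClass_gaussianReal (μ := 0) (v := 1) one_ne_zero
    have hne : ∀ᵐ z ∂gaussianReal 0 1, z ≠ 0 := by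
      rw [ae_iff]
      simp
    refine integral_congr_ae ?_
    filter_upwards [hne] with z hz
    rcases lt_or_gt_of_ne hz with h | h <;> simp [halfLineCost, h, h.le]
  have hneg : Integrable (fun z => halfLineCost (-z)) (gaussianReal 0 1) :=
    ((integrable_const (1 : ℝ)).add integrable_sq_gaussian).mono'
      (measurable_halfLineCost.comp measurable_neg).aestronglyMeasurable
      (.of_forall fun z => by simpa using abs_halfLineCost_le (-z))
  rw [integral_add integrable_halfLineCost_gaussian hneg,
    integral_comp_neg_gaussian _ measurable_halfLineCost,
    integral_sub integrable_sq_gaussian (integrable_const _), integral_sq_gaussian] at h1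
  simp at h1
  linarith

lemma integrable_halfLineCost_sub_gaussian (a : ℝ) :
    Integrable (fun z => halfLineCost (z - a)) (gaussianReal 0 1) := by
  refine ((integrable_const (1 + 2 * a ^ 2)).add (integrable_sq_gaussian.const_mul 2)).mono'
    (measurable_halfLineCost.comp (measurable_id.sub_const a)).aestronglyMeasurable
    (.of_forall fun z => (abs_halfLineCost_le _).trans ?_)
  simp only [Pi.add_apply]
  nlinarith [sq_nonneg (z + a)]

/-- Shifting the cost to the right reweights `(t² - 1) e^{-t²/2}` by the decreasing factor
`e^{-at}`, and `t² - 1` changes sign only once, from negative to positive. -/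
lemma integral_halfLineCost_sub_gaussian_nonpos {a : ℝ} (ha : 0 ≤ a) :
    ∫ z, halfLineCost (z - a) ∂gaussianReal 0 1 ≤ 0 := by
  have hpdf : ∀ t, gaussianPDFReal 0 1 (t + a)
      = Real.exp (-(a * t) - a ^ 2 / 2) * gaussianPDFReal 0 1 t := by
    intro t
    rw [gaussianPDFReal_one_eq, gaussianPDFReal_one_eq, mul_left_comm, ← Real.exp_add]
    congr 2
    ring
  have hint : ∀ F : ℝ → ℝ, Integrable F (gaussianReal 0 1) →
      Integrable (fun t => gaussianPDFReal 0 1 t * F t) := by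
    intro F hF
    rw [gaussianReal_of_var_ne_zero _ one_ne_zero, integrable_withDensity_iff_integrable_smul'
      (measurable_gaussianPDF 0 1) (.of_forall fun _ => gaussianPDF_lt_top)] at hF
    simpa using hF
  have hval : ∀ F : ℝ → ℝ, ∫ z, F z ∂gaussianReal 0 1 = ∫ t, gaussianPDFReal 0 1 t * F t := by
    intro F
    rw [integral_gaussianReal_eq_integral_smul one_ne_zero]
    simp only [smul_eq_mul]
  have hshift : ∫ z, halfLineCost (z - a) ∂gaussianReal 0 1
      = ∫ t, gaussianPDFReal 0 1 (t + a) * halfLineCost t := by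
    rw [hval, ← integral_add_right_eq_self _ a]
    simp
  have hI := (hint _ (integrable_halfLineCost_sub_gaussian a)).comp_add_right a
  simp only [add_sub_cancel_right] at hI
  calc ∫ z, halfLineCost (z - a) ∂gaussianReal 0 1
      = ∫ t, gaussianPDFReal 0 1 (t + a) * halfLineCost t := hshift
    _ ≤ ∫ t, Real.exp (-a - a ^ 2 / 2) * (gaussianPDFReal 0 1 t * halfLineCost t) := by
      refine integral_mono hI ((hint _ integrable_halfLineCost_gaussian).const_mul _) fun t => ?_
      simp only [hpdf, ← mul_assoc]
      rw [mul_right_comm, mul_right_comm (Real.exp (-a - a ^ 2 / 2))]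
      refine mul_le_mul_of_nonneg_right ?_ (gaussianPDFReal_nonneg _ _ _)
      unfold halfLineCost
      split_ifs with ht
      · rcases le_total t 1 with h1 | h1
        · refine mul_le_mul_of_nonpos_right (Real.exp_le_exp.2 ?_) (by nlinarith)
          nlinarith
        · refine mul_le_mul_of_nonneg_right (Real.exp_le_exp.2 ?_) (by nlinarith)
          nlinarith
      · simp
    _ = 0 := by rw [integral_const_mul, ← hval, integral_halfLineCost_gaussian, mul_zero]

/-- The cost `(t² - 1) / 2` at distance `t > 0` outside `[-A, A]`, and `0` inside. -/
noncomputable def outsideCost (A y : ℝ) : ℝ := (halfLineCost (y - A) + halfLineCost (-y - A)) / 2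

lemma measurable_outsideCost (A : ℝ) : Measurable (outsideCost A) := by
  have := measurable_halfLineCost
  unfold outsideCost
  fun_prop

lemma outsideCost_eq_zero {A y : ℝ} (hy : |y| ≤ A) : outsideCost A y = 0 := by
  rw [abs_le] at hy
  simp [outsideCost, halfLineCost, show ¬ A < y by linarith, show ¬ 0 < -y - A by linarith]

lemma abs_outsideCost_le (A y : ℝ) : |outsideCost A y| ≤ (1 + 2 * A ^ 2) + 2 * y ^ 2 := by
  have h1 := abs_halfLineCost_le (y - A)
  have h2 := abs_halfLineCost_le (-y - A)
  rw [outsideCost, abs_div, abs_two]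
  have := abs_add_le (halfLineCost (y - A)) (halfLineCost (-y - A))
  nlinarith [sq_nonneg (y - A), sq_nonneg (y + A)]

/-- From any admissible input the expected cost is nonpositive: the two ends of `[-A, A]`
contribute separately. -/
lemma integral_outsideCost_gaussian_nonpos {A x : ℝ} (hx : |x| ≤ A) :
    ∫ z, outsideCost A (x + z) ∂gaussianReal 0 1 ≤ 0 := by
  rw [abs_le] at hx
  have h1 : ∀ z, halfLineCost (x + z - A) = halfLineCost (z - (A - x)) := by
    intro z; congr 1; ring
  have h2 : ∀ z, halfLineCost (-(x + z) - A) = halfLineCost (-z - (A + x)) := by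
    intro z; congr 1; ring
  have hi2 : Integrable (fun z => halfLineCost (-z - (A + x))) (gaussianReal 0 1) := by
    refine ((integrable_const (1 + 2 * (A + x) ^ 2)).add
      (integrable_sq_gaussian.const_mul 2)).mono'
      (measurable_halfLineCost.comp (measurable_neg.sub_const (A + x))).aestronglyMeasurable
      (.of_forall fun z => (abs_halfLineCost_le _).trans ?_)
    simp only [Pi.add_apply]
    nlinarith [sq_nonneg (z - (A + x))]
  simp only [outsideCost, h1, h2]
  rw [integral_div, integral_add (integrable_halfLineCost_sub_gaussian _) hi2,
    integral_comp_neg_gaussian (fun z => halfLineCost (z - (A + x)))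
      (measurable_halfLineCost.comp (measurable_id.sub_const _))]
  have := integral_halfLineCost_sub_gaussian_nonpos (show 0 ≤ A - x by linarith)
  have := integral_halfLineCost_sub_gaussian_nonpos (show 0 ≤ A + x by linarith)
  linarith

/-- The reference density: `1 / (2A)` on `[-A, A]`, continued outside by a Gaussian tail that is
raised by the factor `√e`. Its total mass exceeds `1` slightly; it is left unnormalised. -/
noncomputable def refDensity (A y : ℝ) : ℝ := (2 * A)⁻¹ * Real.exp (-outsideCost A y)

/-- The part of the reference density outside `[-A, A]`. -/
noncomputable def refTail (A y : ℝ) : ℝ :=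
  refDensity A y - (Set.Icc (-A) A).indicator (fun _ => (2 * A)⁻¹) y

section Reference

variable {A : ℝ}

lemma refDensity_pos (hA : 0 < A) (y : ℝ) : 0 < refDensity A y := by
  unfold refDensity; positivity

lemma log_refDensity (hA : 0 < A) (y : ℝ) :
    Real.log (refDensity A y) = -Real.log (2 * A) - outsideCost A y := by
  rw [refDensity, Real.log_mul (by positivity) (Real.exp_pos _).ne', Real.log_exp, Real.log_inv]
  ring

lemma refTail_eq_zero {y : ℝ} (hy : |y| ≤ A) : refTail A y = 0 := by
  have : y ∈ Set.Icc (-A) A := abs_le.1 hy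
  simp [refTail, refDensity, outsideCost_eq_zero hy, this]

lemma refTail_eq {y : ℝ} (hy : A < |y|) : refTail A y = refDensity A y := by
  have : y ∉ Set.Icc (-A) A := fun h => hy.not_ge (abs_le.2 h)
  simp [refTail, this]

lemma refTail_nonneg (hA : 0 < A) (y : ℝ) : 0 ≤ refTail A y := by
  rcases le_or_gt |y| A with h | h
  · rw [refTail_eq_zero h]
  · rw [refTail_eq h]; exact (refDensity_pos hA y).le

lemma b0_eq : b0 = √(2 * Real.pi) * Real.exp (1 / 2) / 2 := by
  rw [b0, Real.sqrt_eq_iff_mul_self_eq (by positivity) (by positivity)]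
  have h1 : √(2 * Real.pi) * √(2 * Real.pi) = 2 * Real.pi := Real.mul_self_sqrt (by positivity)
  have h2 : Real.exp (1 / 2) * Real.exp (1 / 2) = Real.exp 1 := by rw [← Real.exp_add]; norm_num
  linear_combination -(Real.exp (1 / 2) * Real.exp (1 / 2) / 4) * h1 - Real.pi / 2 * h2

lemma b0_pos : 0 < b0 := by
  rw [b0_eq]; positivity

lemma refTail_le (hA : 0 < A) (y : ℝ) :
    refTail A y ≤ b0 / A * (gaussianPDFReal A 1 y + gaussianPDFReal (-A) 1 y) := by
  have hp1 := gaussianPDFReal_nonneg A 1 y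
  have hp2 := gaussianPDFReal_nonneg (-A) 1 y
  have hb : 0 < b0 / A := div_pos b0_pos hA
  have hpi : √(2 * Real.pi) ≠ 0 := (Real.sqrt_pos.2 (by positivity)).ne'
  rcases le_or_gt |y| A with h | h
  · rw [refTail_eq_zero h]; positivity
  rw [refTail_eq h, refDensity]
  rcases lt_abs.1 h with h | h
  · have hc : -outsideCost A y = 1 / 2 + -(y - A) ^ 2 / 2 := by
      simp only [outsideCost, halfLineCost, sub_pos, h, if_true, show ¬ A < -y by linarith,
        if_false]
      ring
    calc _ = b0 / A * gaussianPDFReal A 1 y := by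
            rw [hc, Real.exp_add, gaussianPDFReal_one_eq, b0_eq]
            field_simp
      _ ≤ _ := mul_le_mul_of_nonneg_left (by linarith) hb.le
  · have hc : -outsideCost A y = 1 / 2 + -(y - -A) ^ 2 / 2 := by
      simp only [outsideCost, halfLineCost, sub_pos, h, if_true, show ¬ A < y by linarith,
        if_false]
      ring
    calc _ = b0 / A * gaussianPDFReal (-A) 1 y := by
            rw [hc, Real.exp_add, gaussianPDFReal_one_eq, b0_eq]
            field_simp
      _ ≤ _ := mul_le_mul_of_nonneg_left (by linarith) hb.le

lemma measurable_refDensity : Measurable (refDensity A) := by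
  have := measurable_outsideCost A
  unfold refDensity
  fun_prop

lemma measurable_refTail : Measurable (refTail A) :=
  measurable_refDensity.sub (measurable_const.indicator measurableSet_Icc)

lemma integrable_refTail (hA : 0 < A) : Integrable (refTail A) := by
  refine (((integrable_gaussianPDFReal A 1).add (integrable_gaussianPDFReal (-A) 1)).const_mul
    (b0 / A)).mono' measurable_refTail.aestronglyMeasurable (.of_forall fun y => ?_)
  rw [Real.norm_of_nonneg (refTail_nonneg hA y)]
  exact refTail_le hA y

lemma integral_refTail_le (hA : 0 < A) : ∫ y, refTail A y ≤ 2 * b0 / A := by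
  have h := integral_mono (integrable_refTail hA)
    (((integrable_gaussianPDFReal A 1).add (integrable_gaussianPDFReal (-A) 1)).const_mul
    (b0 / A)) (refTail_le hA)
  simp only [Pi.add_apply] at h
  rw [integral_const_mul, integral_add (integrable_gaussianPDFReal A 1)
    (integrable_gaussianPDFReal (-A) 1), integral_gaussianPDFReal_eq_one _ one_ne_zero,
    integral_gaussianPDFReal_eq_one _ one_ne_zero] at h
  refine h.trans_eq ?_
  ring

lemma refDensity_eq (A y : ℝ) :
    refDensity A y = (Set.Icc (-A) A).indicator (fun _ => (2 * A)⁻¹) y + refTail A y := by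
  rw [refTail]; ring

lemma integrable_uniformDensity (A : ℝ) :
    Integrable ((Set.Icc (-A) A).indicator fun _ => (2 * A)⁻¹) :=
  (integrable_indicator_iff measurableSet_Icc).2 (integrableOn_const (by simp))

lemma integrable_refDensity (hA : 0 < A) : Integrable (refDensity A) := by
  have : refDensity A = fun y =>
      (Set.Icc (-A) A).indicator (fun _ => (2 * A)⁻¹) y + refTail A y :=
    funext (refDensity_eq A)
  rw [this]
  exact (integrable_uniformDensity A).add (integrable_refTail hA)

lemma integral_refDensity_le (hA : 0 < A) : ∫ y, refDensity A y ≤ 1 + 2 * b0 / A := by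
  simp_rw [refDensity_eq A]
  rw [integral_add (integrable_uniformDensity A) (integrable_refTail hA),
    integral_indicator measurableSet_Icc]
  have h : ∫ _ in Set.Icc (-A) A, (2 * A)⁻¹ = 1 := by
    rw [setIntegral_const, Real.volume_real_Icc_of_le (by linarith), smul_eq_mul]
    field_simp
    ring
  rw [h]
  have := integral_refTail_le hA
  linarith

end Reference

/-! ### From relative entropy to the `L¹` distance -/

/-- A pointwise form of Pinsker's inequality, weak in the constants: it follows from
`u log (u / v) - u + v ≥ (√u - √v)²`. -/
lemma abs_sub_le_relEntropy {u v s : ℝ} (hu : 0 < u) (hv : 0 < v) (hs : 0 < s) :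
    |u - v| ≤ (2 * s)⁻¹ * (u * (Real.log u - Real.log v) - u + v) + s * (u + v) := by
  obtain ⟨a, ha, rfl⟩ : ∃ a, 0 < a ∧ a ^ 2 = u := ⟨√u, Real.sqrt_pos.2 hu, Real.sq_sqrt hu.le⟩
  obtain ⟨b, hb, rfl⟩ : ∃ b, 0 < b ∧ b ^ 2 = v := ⟨√v, Real.sqrt_pos.2 hv, Real.sq_sqrt hv.le⟩
  have hlog : 1 - b / a ≤ Real.log a - Real.log b := by
    rw [← Real.log_div ha.ne' hb.ne']
    have := Real.one_sub_inv_le_log_of_pos (div_pos ha hb)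
    rwa [inv_div] at this
  have h1 : (a - b) ^ 2 ≤ a ^ 2 * (Real.log (a ^ 2) - Real.log (b ^ 2)) - a ^ 2 + b ^ 2 := by
    rw [Real.log_pow, Real.log_pow]
    have h2 : a ^ 2 * (1 - b / a) = a ^ 2 - a * b := by field_simp
    have h3 := mul_le_mul_of_nonneg_left hlog (sq_nonneg a)
    push_cast
    nlinarith
  have h4 : |a ^ 2 - b ^ 2| = |a - b| * (a + b) := by
    rw [sq_sub_sq, abs_mul, abs_of_pos (by positivity : 0 < a + b), mul_comm]
  have h5 : |a - b| * (a + b) ≤ (2 * s)⁻¹ * (a - b) ^ 2 + s / 2 * (a + b) ^ 2 := by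
    have h6 := sq_nonneg (|a - b| - s * (a + b))
    have h7 : |a - b| ^ 2 = (a - b) ^ 2 := sq_abs _
    have h8 : (2 * s)⁻¹ * (a - b) ^ 2 + s / 2 * (a + b) ^ 2 - |a - b| * (a + b)
        = (2 * s)⁻¹ * (|a - b| - s * (a + b)) ^ 2 := by
      rw [← h7]; field_simp; ring
    have : 0 ≤ (2 * s)⁻¹ * (|a - b| - s * (a + b)) ^ 2 := by positivity
    linarith
  have h9 := mul_le_mul_of_nonneg_left h1 (by positivity : 0 ≤ (2 * s)⁻¹)
  have h10 : s / 2 * (a + b) ^ 2 ≤ s * (a ^ 2 + b ^ 2) := by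
    nlinarith [mul_nonneg hs.le (sq_nonneg (a - b))]
  rw [h4]
  linarith

/-- The output density of a near-optimal input is close in `L¹` to the reference density. -/
theorem IsNearOptimal.integral_abs_sub_le {A ε : ℝ} (hA : 0 < A) (hε : 0 ≤ ε)
    {P : Measure ℝ} (h : IsNearOptimal ε A P) {s : ℝ} (hs : 0 < s) :
    ∫ y, |outputDensity P y - refDensity A y|
      ≤ (2 * s)⁻¹ * (ε + 2 * b0 / A) + s * (2 + 2 * b0 / A) := by
  have := h.1.1
  have hP := h.1.ae_abs_le
  set f := outputDensity P with hf
  set q := refDensity A with hq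
  have hcost : Integrable (outsideCost A) (outputLaw P) :=
    integrable_outputLaw_of_le hP (measurable_outsideCost A) (abs_outsideCost_le A)
  have hlogf := integrable_log_outputDensity hP
  have hlogq : Integrable (fun y => Real.log (q y)) (outputLaw P) := by
    simp_rw [hq, log_refDensity hA]
    exact (integrable_const _).sub hcost
  have hI1 : Integrable (fun y => f y * (Real.log (f y) - Real.log (q y))) :=
    integrable_outputLaw_iff.1 (hlogf.sub hlogq)
  have hIf : Integrable f := integrable_outputDensity
  have hIq : Integrable q := integrable_refDensity hA
  have hcost0 : ∫ y, outsideCost A y ∂outputLaw P ≤ 0 := by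
    rw [integral_outputLaw_eq_prod hcost]
    refine integral_nonpos_of_ae ?_
    filter_upwards [hP] with x hx
    exact integral_outsideCost_gaussian_nonpos hx
  have hKL : ∫ y, f y * (Real.log (f y) - Real.log (q y)) ≤ ε := by
    rw [← integral_outputLaw, integral_sub hlogf hlogq]
    simp_rw [hq, log_refDensity hA]
    rw [integral_sub (integrable_const _) hcost]
    have := h.integral_log_outputDensity_le hA hε
    simp only [integral_const, probReal_univ, smul_eq_mul, one_mul]
    linarith
  have hf1 : ∫ y, f y = 1 := integral_outputDensity
  have hq1 : ∫ y, q y ≤ 1 + 2 * b0 / A := integral_refDensity_le hA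
  have hI2 : Integrable (fun y => f y * (Real.log (f y) - Real.log (q y)) - f y) := hI1.sub hIf
  have hIrel : Integrable (fun y => f y * (Real.log (f y) - Real.log (q y)) - f y + q y) :=
    hI2.add hIq
  have hIsum : Integrable (fun y => f y + q y) := hIf.add hIq
  have hmono := integral_mono (hIf.sub hIq).abs
    ((hIrel.const_mul (2 * s)⁻¹).add (hIsum.const_mul s))
    fun y => abs_sub_le_relEntropy (outputDensity_pos (P := P) y) (refDensity_pos hA y) hs
  simp only [Pi.add_apply, Pi.sub_apply] at hmono
  rw [integral_add (hIrel.const_mul _) (hIsum.const_mul s), integral_const_mul,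
    integral_add hI2 hIq, integral_sub hI1 hIf, integral_const_mul,
    integral_add hIf hIq, hf1] at hmono
  refine hmono.trans ?_
  have h2s : 0 ≤ (2 * s)⁻¹ := by positivity
  exact add_le_add (mul_le_mul_of_nonneg_left (by linarith) h2s)
    (mul_le_mul_of_nonneg_left (by linarith) hs.le)

/-! ### Testing the output of a near-optimal input -/

/-- A near-optimal input with finitely many support points is tested against the function of
`exists_testFunction`: its output integrates to at most `0`, the reference density to at least
`3 / 8` up to the tails, so the `L¹` distance cannot be small. -/
theorem IsNearOptimal.one_le_mul_exp {A ε : ℝ} (hA : 0 < A) (hε : 0 < ε) {P : Measure ℝ}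
    (h : IsNearOptimal ε A P) (hfin : P.support.Finite) :
    1 ≤ 144 * √((ε + b0 / A) / 2) *
      Real.exp (2 * (Real.pi * P.support.ncard / A) ^ 2) := by
  have := h.1.1
  have hP := h.1.ae_abs_le
  have hb : 0 < b0 / A := div_pos b0_pos hA
  obtain ⟨g, hgc, hgb, hgn, hgm⟩ := exists_testFunction hA hfin.toFinset fun x hx =>
    abs_le.2 (h.1.2 (hfin.mem_toFinset.1 hx))
  rw [← Set.ncard_eq_toFinset_card _ hfin] at hgb
  set E := Real.exp (2 * (Real.pi * P.support.ncard / A) ^ 2) with hE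
  have hE1 : 1 ≤ E := Real.one_le_exp (by positivity)
  set δ := √((ε + b0 / A) / 2) with hδ
  have hδ0 : 0 < δ := Real.sqrt_pos.2 (by positivity)
  have hδ2 : ε + b0 / A = 2 * δ ^ 2 := by
    rw [hδ, Real.sq_sqrt (by positivity)]; ring
  -- for large `δ` the claim is trivial, for small `δ` the quadratic terms below are absorbed
  rcases le_or_gt 1 (2 * δ) with hbig | hsmall
  · nlinarith
  have hgmeas := hgc.measurable
  have hgPY : Integrable g (outputLaw P) :=
    Integrable.of_bound (C := 6 * E) hgmeas.aestronglyMeasurable (.of_forall hgb)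
  have hout : ∫ y, outputDensity P y * g y ≤ 0 := by
    rw [← integral_outputLaw, integral_outputLaw_eq_prod hgPY]
    refine integral_nonpos_of_ae ?_
    filter_upwards [Measure.support_mem_ae (μ := P)] with x hx
    exact hgn x (hfin.mem_toFinset.2 hx)
  have hIfg : Integrable (fun y => outputDensity P y * g y) := integrable_outputLaw_iff.1 hgPY
  have hmul : ∀ F : ℝ → ℝ, Integrable F → Integrable (fun y => F y * g y) := fun F hF =>
    hF.mul_bdd (c := 6 * E) hgmeas.aestronglyMeasurable (.of_forall hgb)
  have hbound : ∀ F : ℝ → ℝ, Integrable F → |∫ y, F y * g y| ≤ 6 * E * ∫ y, |F y| := by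
    intro F hF
    rw [← integral_const_mul]
    refine abs_integral_le_integral_abs.trans (integral_mono (hmul F hF).abs
      (hF.abs.const_mul _) fun y => ?_)
    rw [abs_mul, mul_comm]
    exact mul_le_mul_of_nonneg_right (hgb y) (abs_nonneg _)
  have hIf := integrable_outputDensity (P := P)
  have hIq := integrable_refDensity hA
  have hIt := integrable_refTail hA
  have hdiff := hbound (fun y => outputDensity P y - refDensity A y) (hIf.sub hIq)
  have htail := hbound (refTail A) hIt
  have habs : ∫ y, |refTail A y| = ∫ y, refTail A y :=
    integral_congr_ae (.of_forall fun y => abs_of_nonneg (refTail_nonneg hA y))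
  rw [habs] at htail
  have htail2 := integral_refTail_le hA
  -- `s` is the square root of the bound `4 δ²` on the relative entropy, which balances both terms
  have hL1 := h.integral_abs_sub_le hA hε.le (s := 2 * δ) (by positivity)
  have hL1' : ∫ y, |outputDensity P y - refDensity A y| ≤ 7 * δ := by
    refine hL1.trans ?_
    have h1 : 2 * b0 / A ≤ 1 := by
      rw [mul_div_assoc]; nlinarith
    have h2 : ε + 2 * b0 / A ≤ 4 * δ ^ 2 := by
      rw [mul_div_assoc]; linarith
    have h3 : (2 * (2 * δ))⁻¹ * (ε + 2 * b0 / A) ≤ δ := by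
      rw [inv_mul_le_iff₀ (by positivity)]; linarith
    nlinarith
  have hmain : ∫ y, refDensity A y * g y
      = (2 * A)⁻¹ * (∫ y in (-A)..A, g y) + ∫ y, refTail A y * g y := by
    have h1 : ∀ y, refDensity A y * g y
        = (Set.Icc (-A) A).indicator (fun y => (2 * A)⁻¹ * g y) y + refTail A y * g y := by
      intro y
      rw [refDensity_eq, add_mul]
      congr 1
      by_cases hy : y ∈ Set.Icc (-A) A <;> simp [hy]
    have h2 : Integrable ((Set.Icc (-A) A).indicator (fun y => (2 * A)⁻¹ * g y)) :=
      (integrable_indicator_iff measurableSet_Icc).2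
        (Continuous.integrableOn_Icc (by fun_prop))
    simp_rw [h1]
    rw [integral_add h2 (hmul _ hIt), integral_indicator measurableSet_Icc,
      integral_const_mul, intervalIntegral.integral_of_le (by linarith), integral_Icc_eq_integral_Ioc]
  have hmean : 3 / 8 ≤ (2 * A)⁻¹ * ∫ y in (-A)..A, g y := by
    rw [le_inv_mul_iff₀ (by positivity)]; linarith
  have hsub : ∫ y, (outputDensity P y - refDensity A y) * g y
      = (∫ y, outputDensity P y * g y) - ∫ y, refDensity A y * g y := by
    simp_rw [sub_mul]
    exact integral_sub hIfg (hmul _ hIq)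
  rw [hsub] at hdiff
  have hd := (abs_le.1 hdiff).1
  have ht := (abs_le.1 htail).1
  have hE6 : 0 < 6 * E := by linarith
  have h5 := mul_le_mul_of_nonneg_left hL1' hE6.le
  have h6 : 6 * E * ∫ y, refTail A y ≤ 6 * E * (2 * δ) := by
    refine mul_le_mul_of_nonneg_left (htail2.trans ?_) hE6.le
    rw [mul_div_assoc]
    nlinarith
  have h7 : 3 / 8 ≤ 6 * E * (7 * δ) + 6 * E * (2 * δ) := by linarith
  linarith

/-! ### The constants and the bound on the support size -/

lemma alpha0_pos : 0 < alpha0 :=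
  intervalIntegral.intervalIntegral_pos_of_pos (Continuous.intervalIntegrable (by fun_prop) _ _)
    (fun _ => Real.exp_pos _) (by norm_num)

lemma alpha0_le_two : alpha0 ≤ 2 := by
  have h := intervalIntegral.integral_mono_on (a := (-1 : ℝ)) (b := 1)
    (f := fun t : ℝ => Real.exp (-t ^ 2 / 2)) (g := fun _ => (1 : ℝ)) (μ := volume) (by norm_num)
    (Continuous.intervalIntegrable (by fun_prop) _ _) (by simp) fun t _ =>
      Real.exp_le_one_iff.2 (by nlinarith [sq_nonneg t])
  have h2 : ∫ _ in (-1 : ℝ)..1, (1 : ℝ) = 2 := by norm_num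
  rw [alpha0]
  linarith

lemma three_le_M0 : 3 ≤ M0 := by
  have he : 1 ≤ Real.exp 1 ^ 2 := one_le_pow₀ (Real.one_le_exp (by norm_num))
  have hpi := Real.pi_pos
  have h1 : 3 / Real.pi ≤ 3 / Real.pi + 1 / √(2 * Real.pi) := by
    have : 0 ≤ 1 / √(2 * Real.pi) := by positivity
    linarith
  have h2 : 1 ≤ 2 * Real.exp 1 ^ 2 / alpha0 := by
    rw [one_le_div alpha0_pos]
    linarith [alpha0_le_two]
  have h3 : Real.pi ≤ Real.pi * Real.exp 1 ^ 2 := le_mul_of_one_le_right hpi.le he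
  calc (3 : ℝ) = 3 / Real.pi * 1 * Real.pi := by field_simp
    _ ≤ M0 := by unfold M0; gcongr

lemma cL_pos : 0 < cL := by
  have := three_le_M0
  have := Real.pi_pos
  unfold cL
  positivity

lemma cL_le : cL ≤ 1 / 144 := by
  have h1 := three_le_M0
  have h2 := Real.pi_gt_three
  unfold cL
  refine one_div_le_one_div_of_le (by norm_num) ?_
  nlinarith

/-- Both bounds of the theorem follow from this one, which merges the two square roots into one
and is stronger in the exponent. -/
theorem IsNearOptimal.posLog_le {A ε : ℝ} (hA : 0 < A) (hε : 0 < ε) {P : Measure ℝ}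
    (h : IsNearOptimal ε A P) (hfin : P.support.Finite) :
    Real.posLog (cL / √((ε + b0 / A) / 2)) ≤ 2 * (Real.pi * P.support.ncard / A) ^ 2 := by
  have h1 := h.one_le_mul_exp hA hε hfin
  have hb : 0 < b0 / A := div_pos b0_pos hA
  have hδ : 0 < √((ε + b0 / A) / 2) := Real.sqrt_pos.2 (by positivity)
  have hpos : 0 < cL / √((ε + b0 / A) / 2) := div_pos cL_pos hδ
  refine max_le (by positivity) ?_
  rw [Real.log_le_iff_le_exp hpos, div_le_iff₀ hδ]
  linarith [cL_le]

/-- Transfers a bound valid for all finitely supported near-optimal inputs to `minSupportSize`;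
inputs with infinite support, and the case in which there is no near-optimal input, are trivial. -/
lemma ofReal_mul_sqrt_le_minSupportSize {A ε a t : ℝ} (hA : 0 < A) (ha : 0 ≤ a)
    (haA : a * (2 * Real.pi) ≤ A)
    (ht : ∀ P : Measure ℝ, IsNearOptimal ε A P → P.support.Finite →
      t ≤ (2 * Real.pi * P.support.ncard / A) ^ 2) :
    ENNReal.ofReal (a * √t) ≤ (minSupportSize ε A : ENNReal) := by
  rcases Set.eq_empty_or_nonempty
    {k : ℕ∞ | ∃ P : Measure ℝ, IsNearOptimal ε A P ∧ k = P.support.encard} with he | hne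
  · rw [minSupportSize, he]
    simp
  obtain ⟨P, hP, hk⟩ := csInf_mem hne
  rw [minSupportSize, hk]
  rcases P.support.finite_or_infinite with hfin | hinf
  · rw [← hfin.cast_ncard_eq]
    simp only [ENat.toENNReal_coe]
    rw [← ENNReal.ofReal_natCast]
    refine ENNReal.ofReal_le_ofReal ?_
    have hpi := Real.pi_pos
    calc a * √t ≤ a * (2 * Real.pi * P.support.ncard / A) := by
          gcongr
          exact Real.sqrt_le_iff.2 ⟨by positivity, ht P hP hfin⟩
      _ = a * (2 * Real.pi) * (P.support.ncard / A) := by ring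
      _ ≤ A * (P.support.ncard / A) := by gcongr
      _ = P.support.ncard := by field_simp
  · rw [hinf.encard_eq]
    simp

end AmplitudeChannel

theorem mainTheorem3 (A ε : ℝ) (hA : 1 ≤ A) (hε : 0 < ε) (hεA : ε ≤ 1 / A) :
    ENNReal.ofReal (A / (2 * Real.pi) *
        √(Real.posLog (AmplitudeChannel.cL /
          (√(ε / 2) + √(AmplitudeChannel.b0 / (2 * A))))))
      ≤ (AmplitudeChannel.minSupportSize ε A : ENNReal) ∧
    ENNReal.ofReal (A / (2 * √2 * Real.pi) *
        √(Real.posLog (AmplitudeChannel.c0 * A)))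
      ≤ (AmplitudeChannel.minSupportSize ε A : ENNReal) := by
  have hA0 : 0 < A := by linarith
  have hb := AmplitudeChannel.b0_pos
  have hc := AmplitudeChannel.cL_pos
  have hpi := Real.pi_pos
  have hbA : 0 < AmplitudeChannel.b0 / A := div_pos hb hA0
  have hδ : 0 < √((ε + AmplitudeChannel.b0 / A) / 2) := Real.sqrt_pos.2 (by positivity)
  constructor
  · refine AmplitudeChannel.ofReal_mul_sqrt_le_minSupportSize hA0 (by positivity) ?_
      fun P hP hfin => ?_
    · exact (div_mul_cancel₀ A (by positivity)).le
    · have h1 : √((ε + AmplitudeChannel.b0 / A) / 2)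
          ≤ √(ε / 2) + √(AmplitudeChannel.b0 / (2 * A)) := by
        rw [Real.sqrt_le_left (by positivity), add_sq, Real.sq_sqrt (by positivity),
          Real.sq_sqrt (by positivity)]
        have h2 : (ε + AmplitudeChannel.b0 / A) / 2
            = ε / 2 + AmplitudeChannel.b0 / (2 * A) := by field_simp
        have h3 : 0 ≤ 2 * √(ε / 2) * √(AmplitudeChannel.b0 / (2 * A)) := by positivity
        linarith
      refine (Real.posLog_le_posLog (by positivity) (div_le_div_of_nonneg_left hc.le hδ h1)).trans
        ((hP.posLog_le hA0 hε hfin).trans ?_)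
      have := sq_nonneg (Real.pi * P.support.ncard / A)
      linear_combination 2 * this
  · refine AmplitudeChannel.ofReal_mul_sqrt_le_minSupportSize hA0 (by positivity) ?_
      fun P hP hfin => ?_
    · have h2 : 1 ≤ √2 := Real.one_le_sqrt.2 (by norm_num)
      rw [div_mul_eq_mul_div, div_le_iff₀ (by positivity)]
      have := mul_le_mul_of_nonneg_left h2 (by positivity : 0 ≤ A * (2 * Real.pi))
      linarith
    · -- by `ε ≤ 1 / A`, `c0 * A` is at most the square of the argument in `posLog_le`
      have h1 : AmplitudeChannel.c0 * A
          ≤ (AmplitudeChannel.cL / √((ε + AmplitudeChannel.b0 / A) / 2)) ^ 2 := by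
        rw [div_pow, Real.sq_sqrt (by positivity), AmplitudeChannel.c0]
        calc 2 * AmplitudeChannel.cL ^ 2 / (1 + AmplitudeChannel.b0) * A
            = AmplitudeChannel.cL ^ 2 / ((1 / A + AmplitudeChannel.b0 / A) / 2) := by field_simp
          _ ≤ _ := by gcongr
      have h0 : 0 ≤ AmplitudeChannel.c0 * A := by
        unfold AmplitudeChannel.c0
        positivity
      have h2 := Real.posLog_le_posLog h0 h1
      rw [Real.posLog_pow] at h2
      have h3 := hP.posLog_le hA0 hε hfin
      push_cast at h2
      linear_combination h2 + 2 * h3
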